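/- Let $n\ge 1$, $1\le k\le n$, $p>1$, $\alpha>-1$, $\beta<p-1$, $c\ge 0$ and $f(t)=e^{ct}$. For $\lambda\in\mathbb R^n$ put $$S_k(\lambda)=\sum_{i_1<\dots<i_k}\lambda_{i_1}\cdots\lambda_{i_k},\qquad \Pi_k(\lambda)=\prod_{i_1<\dots<i_k}(\lambda_{i_1}+\dots+\lambda_{i_k}),$$ $$\Gamma_k=\{\lambda: S_i(\lambda)>0,\ i=1,\dots,k\},\qquad \mathcal P_k=\{\lambda:\lambda_{i_1}+\dots+\lambda_{i_k}>0\ \text{ for all } i_1<\dots<i_k\}.$$ Consider the equations $$S_k^{1/k}\big[D(|Du|^{p-2}Du)\big]=|x|^\alpha|Du|^\beta f(u)\quad\text{in }\mathbb R^n,\tag{1.5}$$ $$\Pi_k^{1/\binom nk}\big[D(|Du|^{p-2}Du)\big]=|x|^\alpha|Du|^\beta f(u)\quad\text{in }\mathbb R^n,\tag{1.6}$$ where the operators are evaluated at the eigenvalues $\lambda$ of the matrix $D(|Du|^{p-2}Du)$, and $|Du|^{p-2}Du:=0$ where $Du=0$. An *entire nontrivial admissible subsolution* of (1.5) is a nonconstant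 function $u\in C^1(\mathbb R^n)\cap C^2(\mathbb R^n\setminus\{0\})$ such that, at every $x\ne 0$, the field $|Du|^{p-2}Du$ is differentiable, the eigenvalues of $D(|Du|^{p-2}Du)$ are real and form a vector in $\Gamma_k$, and the left-hand side of (1.5) is $\ge$ the right-hand side (for $\beta<0$ the right-hand side is $+\infty$ where $Du=0$, so that $Du\neq0$ is required; $|Du|^0=1$). For (1.6) the definition is the same with $\mathcal P_k$ in place of $\Gamma_k$. Then, for equation (1.5) with $\alpha_0=\frac1k-1$, and for equation (1.6) with $\alpha_0=\frac kn-1$: (i) if $p\le\alpha+\beta+2$, the equation has an entire nontrivial admissible subsolution $u\in C^2(\mathbb R^n)$ if and only if $c=0$; (ii) if $p>\alpha+\beta+2$ and $(p-1)\alpha+\beta\ge0$, then for every $\delta\in\big(1,\frac{p-\beta-1}{p-\alpha-\beta-2}\big)$ the equation has an entire nontrivial admissible subsolution $u\in W^{2,\delta}_{loc}(\mathbb R^n)$ if and only if $c=0$; (iii) if $\alpha<\alpha_0$ (with no further condition on $p,\alpha,\beta$), the equation has an entire nontrivial admissible subsolution if and only if $c=0$. -/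

import Mathlib

noncomputable section

/-- Euclidean space `ℝⁿ`. -/
abbrev RSpace (n : ℕ) : Type := EuclideanSpace ℝ (Fin n)

/-- The vector field `|Du|^{p-2} Du` (with value `0` where `Du = 0`). -/
def pGradient {n : ℕ} (p : ℝ) (u : RSpace n → ℝ) (x : RSpace n) : RSpace n :=
  ‖gradient u x‖ ^ (p - 2) • gradient u x

/-- `lam` lists the eigenvalues of `A`, all of them real, with algebraic multiplicity. It is
determined by `A` up to a permutation of the coordinates. -/
def IsEigenvalueVector {n : ℕ} (A : RSpace n →L[ℝ] RSpace n) (lam : Fin n → ℝ) : Prop :=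
  (A : RSpace n →ₗ[ℝ] RSpace n).charpoly =
    ∏ i, (Polynomial.X - Polynomial.C (lam i))

/-- `S_k(λ)`, the sum of all `k`-fold products `λ_{i_1} ⋯ λ_{i_k}`, `i_1 < ⋯ < i_k`. -/
def sumOfProducts {n : ℕ} (k : ℕ) (lam : Fin n → ℝ) : ℝ :=
  ∑ s ∈ Finset.powersetCard k (Finset.univ : Finset (Fin n)), ∏ i ∈ s, lam i

/-- `Π_k(λ)`, the product of all `k`-fold sums `λ_{i_1} + ⋯ + λ_{i_k}`, `i_1 < ⋯ < i_k`. -/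
def productOfSums {n : ℕ} (k : ℕ) (lam : Fin n → ℝ) : ℝ :=
  ∏ s ∈ Finset.powersetCard k (Finset.univ : Finset (Fin n)), ∑ i ∈ s, lam i

/-- Gårding's cone `Γ_k = {λ : S_i(λ) > 0, i = 1, …, k}`. -/
def gardingCone (n k : ℕ) : Set (Fin n → ℝ) :=
  {lam | ∀ i : ℕ, 1 ≤ i → i ≤ k → 0 < sumOfProducts i lam}

/-- The cone `P_k = {λ : λ_{i_1} + ⋯ + λ_{i_k} > 0 for all i_1 < ⋯ < i_k}`. -/
def sumCone (n k : ℕ) : Set (Fin n → ℝ) :=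
  {lam | ∀ s ∈ Finset.powersetCard k (Finset.univ : Finset (Fin n)), 0 < ∑ i ∈ s, lam i}

/-- `u` is a nontrivial (that is, nonconstant) admissible subsolution of
`F(λ(D(|Du|^{p-2}Du))) = |x|^α |Du|^β f(u)` relative to the cone `K`: at every `x ≠ 0` the field
`|Du|^{p-2}Du` is differentiable, the eigenvalues of its derivative lie in `K`, and
`F(λ(D(|Du|^{p-2}Du))) ≥ |x|^α |Du|^β f(u)`. If `β < 0`, the right-hand side is infinite where
`Du = 0`, so `Du` must not vanish. (At the origin the weights are in general undefined.) -/
def IsAdmissibleSubsolution {n : ℕ} (K : Set (Fin n → ℝ)) (F : (Fin n → ℝ) → ℝ)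
    (p α β : ℝ) (f : ℝ → ℝ) (u : RSpace n → ℝ) : Prop :=
  (∃ x y, u x ≠ u y) ∧
  ∀ x : RSpace n, x ≠ 0 →
    DifferentiableAt ℝ (pGradient p u) x ∧
    (β < 0 → gradient u x ≠ 0) ∧
    ∃ lam : Fin n → ℝ, IsEigenvalueVector (fderiv ℝ (pGradient p u) x) lam ∧
      lam ∈ K ∧
      ‖x‖ ^ α * ‖gradient u x‖ ^ β * f (u x) ≤ F lam

/-- Nontrivial admissible subsolution of `S_k^{1/k}[D(|Du|^{p-2}Du)] = |x|^α |Du|^β f(u)`. -/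
def IsSubsolutionS {n : ℕ} (k : ℕ) (p α β : ℝ) (f : ℝ → ℝ) (u : RSpace n → ℝ) : Prop :=
  IsAdmissibleSubsolution (gardingCone n k)
    (fun lam => sumOfProducts k lam ^ (1 / (k : ℝ))) p α β f u

/-- Nontrivial admissible subsolution of
`Π_k^{1/C(n,k)}[D(|Du|^{p-2}Du)] = |x|^α |Du|^β f(u)`. -/
def IsSubsolutionPi {n : ℕ} (k : ℕ) (p α β : ℝ) (f : ℝ → ℝ) (u : RSpace n → ℝ) : Prop :=
  IsAdmissibleSubsolution (sumCone n k)
    (fun lam => productOfSums k lam ^ (1 / (n.choose k : ℝ))) p α β f u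

/-- `u ∈ L^δ_loc(ℝⁿ)`. -/
def MemLpLocal {n : ℕ} (δ : ℝ) (u : RSpace n → ℝ) : Prop :=
  ∀ K : Set (RSpace n), IsCompact K →
    MeasureTheory.MemLp u (ENNReal.ofReal δ) (MeasureTheory.volume.restrict K)

/-- `g` is the weak partial derivative `∂_i u` on `ℝⁿ` (for locally integrable `u`, `g`). -/
def IsWeakPartial {n : ℕ} (i : Fin n) (u g : RSpace n → ℝ) : Prop :=
  ∀ φ : RSpace n → ℝ, ContDiff ℝ ((⊤ : ℕ∞) : WithTop ℕ∞) φ → HasCompactSupport φ →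
    ∫ x, u x * fderiv ℝ φ x (EuclideanSpace.single i 1) = -∫ x, g x * φ x

/-- `u ∈ W^{2,δ}_loc(ℝⁿ)`: `u` and its weak derivatives of order one and two are
in `L^δ_loc(ℝⁿ)`. -/
def MemSobolevTwoLocal {n : ℕ} (δ : ℝ) (u : RSpace n → ℝ) : Prop :=
  MemLpLocal δ u ∧
  ∃ (g : Fin n → RSpace n → ℝ) (h : Fin n → Fin n → RSpace n → ℝ),
    (∀ i, MemLpLocal δ (g i) ∧ IsWeakPartial i u (g i)) ∧
    (∀ i j, MemLpLocal δ (h i j) ∧ IsWeakPartial j (g i) (h i j))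

end

/-! ### Algebra of the operators: eigenvalues, and bounds between smallest eigenvalue and trace. -/

noncomputable section
open Finset

/-! Only two facts about the operators matter: F(λ) ≥ t when every λ_i ≥ t > 0, and F(λ) ≤ C Σ λ_i
on the cone (`rpow_sumOfProducts_le`, `rpow_productOfSums_le`). Both equations are therefore
instances of `exists_isAdmissibleSubsolution_iff`.

For c = 0 a multiple of |x|^γ with γ = 1 + (α+1)/(p-1-β) is a subsolution: this exponent gives both
sides the same homogeneity, and the multiple is fixed by the smallest eigenvalue
(`exists_isAdmissibleSubsolution_radialPower`). The function is always C¹, and C² off the origin. It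
is C² everywhere when γ ≥ 2, that is p ≤ α+β+2, and its second derivatives, of size |x|^(γ-2), lie
in L^δ_loc if (γ-2)δ > -1, which is the stated range of δ.

For c > 0 the trace bound gives div(|Du|^{p-2}Du) ≥ c₀|x|^α|Du|^β e^{cu} off the origin, and
`eq_of_le_pLaplacian` shows that u is constant. The inequality is tested with e^{su}φ^N, where φ is
a cutoff at scale R. Differentiating e^{su} produces the good term s|Du|^p e^{su}φ^N; the term with
Dφ is absorbed by a three-term Young inequality (`young_absorption`) into the right-hand side, half
of the good term, and an error free of u. In dimension d a suitable s makes this error O(R^{-d-p})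
pointwise, so ∫|Du|^p e^{su}φ^N = O(R^{-p}) and Du = 0. Since the divergence need not be integrable
near the origin, the integration uses a gauge-type integral (`integral_le_of_le_divergence`). -/

theorem IsEigenvalueVector.trace_eq_sum {n : ℕ} {A : RSpace n →L[ℝ] RSpace n} {lam : Fin n → ℝ}
    (h : IsEigenvalueVector A lam) :
    ∑ i, A (EuclideanSpace.single i 1) i = ∑ i, lam i := by
  have hroots : (A : RSpace n →ₗ[ℝ] RSpace n).charpoly.roots = Finset.univ.val.map lam := by
    rw [h, Polynomial.roots_prod _ _ (Finset.prod_ne_zero_iff.2 fun i _ =>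
      Polynomial.X_sub_C_ne_zero _)]
    simp [Multiset.bind_singleton]
  have hs : (A : RSpace n →ₗ[ℝ] RSpace n).charpoly.Splits := by
    rw [h]
    exact Polynomial.Splits.prod fun i _ => Polynomial.Splits.X_sub_C _
  have h1 := Module.End.trace_eq_sum_roots_charpoly_of_splits hs
  rw [hroots, LinearMap.trace_eq_sum_inner _ (EuclideanSpace.basisFun (Fin n) ℝ)] at h1
  have h2 : (Finset.univ.val.map lam).sum = ∑ i, lam i := rfl
  rw [h2] at h1
  simpa [EuclideanSpace.inner_single_left] using h1

/-- The derivative of a radial field |x|^σ x has this form. The rank-one part has characteristic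
polynomial X^(n+1) - b|x|²X^n, and adding a multiple of the identity shifts the variable. -/
theorem isEigenvalueVector_smul_id_add_smulRight {n : ℕ} (a b : ℝ) (x : RSpace (n + 1)) :
    IsEigenvalueVector (a • ContinuousLinearMap.id ℝ (RSpace (n + 1)) +
        (innerSL ℝ x).smulRight (b • x))
      (Function.update (fun _ => a) 0 (a + b * ‖x‖ ^ 2)) := by
  set B : RSpace (n + 1) →ₗ[ℝ] RSpace (n + 1) := ((innerSL ℝ x).smulRight (b • x) :) with hB
  have h1 : B.charpoly = Polynomial.X ^ (n + 1) - (b * ‖x‖ ^ 2) • Polynomial.X ^ n := by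
    have hm : LinearMap.toMatrix (EuclideanSpace.basisFun (Fin (n + 1)) ℝ).toBasis
        (EuclideanSpace.basisFun (Fin (n + 1)) ℝ).toBasis B =
        Matrix.vecMulVec (fun i => b * x i) (fun i => x i) := by
      ext i j
      simp [LinearMap.toMatrix_apply, hB, Matrix.vecMulVec_apply, EuclideanSpace.inner_single_right]
      ring
    rw [← LinearMap.charpoly_toMatrix B (EuclideanSpace.basisFun (Fin (n + 1)) ℝ).toBasis, hm,
      Matrix.charpoly_vecMulVec]
    simp only [Fintype.card_fin, Nat.add_sub_cancel]
    congr 2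
    rw [EuclideanSpace.norm_sq_eq, Finset.mul_sum]
    simp only [dotProduct, Real.norm_eq_abs, sq_abs]
    exact Finset.sum_congr rfl fun i _ => by ring
  have h2 : ((a • ContinuousLinearMap.id ℝ (RSpace (n + 1)) +
        (innerSL ℝ x).smulRight (b • x) : RSpace (n + 1) →L[ℝ] RSpace (n + 1)) :
        RSpace (n + 1) →ₗ[ℝ] RSpace (n + 1)) = B - (-a) • (1 : Module.End ℝ _) := by
    ext v
    simp [hB]
    ring
  rw [IsEigenvalueVector, h2, LinearMap.charpoly_sub_smul, h1, Fin.prod_univ_succ]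
  simp [pow_succ, Polynomial.smul_eq_C_mul]
  ring

theorem sumOfProducts_one {n : ℕ} (lam : Fin n → ℝ) : sumOfProducts 1 lam = ∑ i, lam i := by
  simp [sumOfProducts, Finset.powersetCard_one]

theorem sq_sum_eq_sum_sq_add {n : ℕ} (lam : Fin n → ℝ) :
    (∑ i, lam i) ^ 2 = ∑ i, lam i ^ 2 + 2 * sumOfProducts 2 lam := by
  suffices h : ∀ S : Finset (Fin n), (∑ i ∈ S, lam i) ^ 2 =
      ∑ i ∈ S, lam i ^ 2 + 2 * ∑ s ∈ powersetCard 2 S, ∏ i ∈ s, lam i from h univ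
  intro S
  induction S using Finset.induction_on with
  | empty =>
    rw [powersetCard_eq_empty.2 (by simp)]
    simp
  | insert a S ha ih =>
    have hd : Disjoint (powersetCard 2 S) ((powersetCard 1 S).image (insert a)) := by
      refine disjoint_left.2 fun s hs hs' => ?_
      obtain ⟨t, -, rfl⟩ := mem_image.1 hs'
      exact ha ((mem_powersetCard.1 hs).1 (mem_insert_self a t))
    rw [powersetCard_succ_insert ha, sum_union hd, sum_insert ha, sum_insert ha, add_sq, ih,
      powersetCard_one, sum_image]
    · have : ∀ i ∈ S, ∏ j ∈ insert a {i}, lam j = lam a * lam i := fun i hi => by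
        rw [prod_insert (by simpa using fun h : a = i => ha (h ▸ hi)), prod_singleton]
      simp only [sum_map, Function.Embedding.coeFn_mk]
      rw [sum_congr rfl this, ← mul_sum]
      ring
    · intro s hs t ht hst
      simp only [coe_map, Function.Embedding.coeFn_mk, Set.mem_image, mem_coe] at hs ht
      obtain ⟨i, hi, rfl⟩ := hs
      obtain ⟨j, hj, rfl⟩ := ht
      have : i ∈ insert a ({j} : Finset (Fin n)) := by
        rw [← hst]
        simp
      simp only [mem_insert, mem_singleton] at this
      rcases this with rfl | rfl
      · exact absurd hi ha
      · rfl

theorem rpow_inv_le_of_le_pow {A B : ℝ} {m : ℕ} (hm : m ≠ 0) (hA : 0 ≤ A) (hB : 0 ≤ B)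
    (h : A ≤ B ^ m) : A ^ (1 / (m : ℝ)) ≤ B := by
  calc A ^ (1 / (m : ℝ)) ≤ (B ^ m) ^ (1 / (m : ℝ)) := Real.rpow_le_rpow hA h (by positivity)
    _ = B := by rw [one_div, Real.pow_rpow_inv_natCast hB hm]

theorem le_rpow_inv_of_pow_le {A B : ℝ} {m : ℕ} (hm : m ≠ 0) (hB : 0 ≤ B)
    (h : B ^ m ≤ A) : B ≤ A ^ (1 / (m : ℝ)) := by
  calc B = (B ^ m) ^ (1 / (m : ℝ)) := by rw [one_div, Real.pow_rpow_inv_natCast hB hm]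
    _ ≤ A ^ (1 / (m : ℝ)) := Real.rpow_le_rpow (by positivity) h (by positivity)

/-- Since S_2 > 0, the identity S_1² = Σ λ_j² + 2 S_2 bounds each λ_i² by S_1². -/
theorem abs_le_sum_of_mem_gardingCone {n k : ℕ} (hk : 2 ≤ k) {lam : Fin n → ℝ}
    (h : lam ∈ gardingCone n k) (i : Fin n) : |lam i| ≤ ∑ j, lam j := by
  have h1 : 0 < ∑ j, lam j := sumOfProducts_one lam ▸ h 1 le_rfl (by omega)
  have h2 := h 2 (by omega) hk
  refine abs_le_of_sq_le_sq ?_ h1.le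
  have := Finset.single_le_sum (f := fun j => lam j ^ 2) (fun j _ => sq_nonneg _)
    (Finset.mem_univ i)
  have h3 := sq_sum_eq_sum_sq_add lam
  linarith

theorem rpow_sumOfProducts_le {n k : ℕ} (hk : 1 ≤ k) {lam : Fin n → ℝ}
    (h : lam ∈ gardingCone n k) :
    sumOfProducts k lam ^ (1 / (k : ℝ)) ≤ (n.choose k + 1 : ℝ) * ∑ i, lam i := by
  have h1 : 0 < ∑ j, lam j := sumOfProducts_one lam ▸ h 1 le_rfl hk
  refine rpow_inv_le_of_le_pow (by omega) (h k hk le_rfl).le (by positivity) ?_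
  have h0 : sumOfProducts k lam ≤ (n.choose k + 1 : ℝ) * (∑ i, lam i) ^ k := by
    -- For k = 1 the cone does not control S_2, but then S_k is the trace itself.
    obtain rfl | hk2 := hk.eq_or_lt
    · rw [sumOfProducts_one, pow_one]
      have : (0 : ℝ) ≤ n.choose 1 := by positivity
      nlinarith
    · calc sumOfProducts k lam
          ≤ ∑ s ∈ powersetCard k (univ : Finset (Fin n)), (∑ i, lam i) ^ k := by
            refine sum_le_sum fun s hs => ?_
            calc ∏ i ∈ s, lam i ≤ |∏ i ∈ s, lam i| := le_abs_self _
              _ = ∏ i ∈ s, |lam i| := abs_prod ..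
              _ ≤ ∏ i ∈ s, ∑ j, lam j := prod_le_prod (fun _ _ => abs_nonneg _)
                  fun i _ => abs_le_sum_of_mem_gardingCone hk2 h i
              _ = _ := by rw [prod_const, (mem_powersetCard.1 hs).2]
        _ = (n.choose k : ℝ) * (∑ i, lam i) ^ k := by simp
        _ ≤ _ := by gcongr; linarith
  refine h0.trans ?_
  rw [mul_pow]
  gcongr
  -- The summand 1 in the constant makes it at least 1, hence at most its own k-th power.
  exact le_self_pow₀ (by linarith [(Nat.cast_nonneg (n.choose k) : (0 : ℝ) ≤ _)]) (by omega)

theorem pow_le_sumOfProducts {n k : ℕ} (hkn : k ≤ n) {lam : Fin n → ℝ} {t : ℝ}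
    (ht : 0 < t) (h : ∀ i, t ≤ lam i) : t ^ k ≤ sumOfProducts k lam := by
  obtain ⟨s, hs⟩ := powersetCard_nonempty.2 (show k ≤ (univ : Finset (Fin n)).card by simpa)
  calc t ^ k = ∏ i ∈ s, t := by rw [prod_const, (mem_powersetCard.1 hs).2]
    _ ≤ ∏ i ∈ s, lam i := prod_le_prod (fun _ _ => ht.le) fun i _ => h i
    _ ≤ _ := single_le_sum (f := fun s => ∏ i ∈ s, lam i)
        (fun s _ => prod_nonneg fun i _ => ht.le.trans (h i)) hs

theorem mem_gardingCone_of_le {n k : ℕ} (hkn : k ≤ n) {lam : Fin n → ℝ} {t : ℝ}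
    (ht : 0 < t) (h : ∀ i, t ≤ lam i) : lam ∈ gardingCone n k := fun i _ hik =>
  (pow_pos ht i).trans_le (pow_le_sumOfProducts (hik.trans hkn) ht h)

theorem le_sum_of_le {n k : ℕ} (hk : 1 ≤ k) {lam : Fin n → ℝ} {t : ℝ}
    (ht : 0 < t) (h : ∀ i, t ≤ lam i) {s : Finset (Fin n)} (hs : s ∈ powersetCard k univ) :
    t ≤ ∑ i ∈ s, lam i := by
  have hc := (mem_powersetCard.1 hs).2
  calc t ≤ k * t := le_mul_of_one_le_left ht.le (by exact_mod_cast hk)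
    _ = ∑ i ∈ s, t := by simp [hc]
    _ ≤ _ := sum_le_sum fun i _ => h i

theorem pow_le_productOfSums {n k : ℕ} (hk : 1 ≤ k) {lam : Fin n → ℝ} {t : ℝ}
    (ht : 0 < t) (h : ∀ i, t ≤ lam i) : t ^ n.choose k ≤ productOfSums k lam := by
  calc t ^ n.choose k = ∏ s ∈ powersetCard k (univ : Finset (Fin n)), t := by simp
    _ ≤ _ := prod_le_prod (fun _ _ => ht.le) fun s hs => le_sum_of_le hk ht h hs

/-- Double counting: each index belongs to (n-1 choose k-1) of the k-element sets, because erasing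
it leaves a (k-1)-element subset of the others. -/
theorem sum_powersetCard_sum {n k : ℕ} (hk : 1 ≤ k) (lam : Fin n → ℝ) :
    ∑ s ∈ powersetCard k (univ : Finset (Fin n)), ∑ i ∈ s, lam i =
      ((n - 1).choose (k - 1) : ℝ) * ∑ i, lam i := by
  have h1 : ∀ i : Fin n, #{s ∈ powersetCard k (univ : Finset (Fin n)) | i ∈ s} =
      (n - 1).choose (k - 1) := fun i => by
    have hc : #(univ.erase i) = n - 1 := by simp
    rw [← hc, ← card_powersetCard]
    refine card_bij' (fun s _ => s.erase i) (fun s _ => insert i s) ?_ ?_ ?_ ?_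
    · intro s hs
      obtain ⟨hs, hi⟩ := mem_filter.1 hs
      refine mem_powersetCard.2 ⟨erase_subset_erase _ (subset_univ _), ?_⟩
      rw [card_erase_of_mem hi, (mem_powersetCard.1 hs).2]
    · intro s hs
      obtain ⟨hs, hc⟩ := mem_powersetCard.1 hs
      have hi : i ∉ s := fun h => by simpa using hs h
      refine mem_filter.2 ⟨mem_powersetCard.2 ⟨subset_univ _, ?_⟩, mem_insert_self _ _⟩
      rw [card_insert_of_notMem hi, hc]
      omega
    · intro s hs
      exact insert_erase (mem_filter.1 hs).2
    · intro s hs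
      exact erase_insert fun h => by simpa using (mem_powersetCard.1 hs).1 h
  calc ∑ s ∈ powersetCard k (univ : Finset (Fin n)), ∑ i ∈ s, lam i
      = ∑ s ∈ powersetCard k (univ : Finset (Fin n)), ∑ i, if i ∈ s then lam i else 0 :=
        sum_congr rfl fun s _ => by simp
    _ = ∑ i, ∑ s ∈ powersetCard k (univ : Finset (Fin n)), if i ∈ s then lam i else 0 := sum_comm
    _ = ∑ i, ((n - 1).choose (k - 1) : ℝ) * lam i := sum_congr rfl fun i _ => by
        rw [← sum_filter, sum_const, h1, nsmul_eq_mul]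
    _ = _ := (mul_sum ..).symm

/-- All k-fold sums are positive on the cone, so each is at most their total, which is a multiple of
the trace. -/
theorem rpow_productOfSums_le {n k : ℕ} (hk : 1 ≤ k) (hkn : k ≤ n) {lam : Fin n → ℝ}
    (h : lam ∈ sumCone n k) :
    productOfSums k lam ^ (1 / (n.choose k : ℝ)) ≤
      ((n - 1).choose (k - 1) : ℝ) * ∑ i, lam i := by
  have hs := sum_powersetCard_sum hk lam
  have hle : ∀ s ∈ powersetCard k (univ : Finset (Fin n)),
      ∑ i ∈ s, lam i ≤ ((n - 1).choose (k - 1) : ℝ) * ∑ i, lam i := fun s hs' => by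
    rw [← hs]
    exact single_le_sum (f := fun s => ∑ i ∈ s, lam i) (fun s hs => (h s hs).le) hs'
  refine rpow_inv_le_of_le_pow (Nat.choose_pos hkn).ne' (prod_nonneg fun s hs => (h s hs).le)
    (hs ▸ sum_nonneg fun s hs => (h s hs).le) ?_
  calc productOfSums k lam ≤ ∏ s ∈ powersetCard k (univ : Finset (Fin n)),
        (((n - 1).choose (k - 1) : ℝ) * ∑ i, lam i) :=
      prod_le_prod (fun s hs => (h s hs).le) hle
    _ = _ := by simp
end

/-! ### Radial fields |x|^σ x and the power-type subsolutions. -/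

noncomputable section

section RadialField

variable {E : Type*} [NormedAddCommGroup E] [InnerProductSpace ℝ E]

theorem hasFDerivAt_norm_rpow_of_ne {x : E} (hx : x ≠ 0) (σ : ℝ) :
    HasFDerivAt (fun y : E => ‖y‖ ^ σ) ((σ * ‖x‖ ^ (σ - 2)) • innerSL ℝ x) x := by
  apply HasStrictFDerivAt.hasFDerivAt
  convert! (hasStrictFDerivAt_norm_sq x).rpow_const (p := σ / 2) (by simp [hx]) using 0
  simp_rw [← Real.rpow_natCast_mul (norm_nonneg _), ← Nat.cast_smul_eq_nsmul ℝ, smul_smul]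
  ring_nf

theorem hasFDerivAt_norm_rpow_smul_of_ne {x : E} (hx : x ≠ 0) (σ : ℝ) :
    HasFDerivAt (fun y : E => ‖y‖ ^ σ • y)
      (‖x‖ ^ σ • ContinuousLinearMap.id ℝ E +
        (innerSL ℝ x).smulRight ((σ * ‖x‖ ^ (σ - 2)) • x)) x := by
  convert! (hasFDerivAt_norm_rpow_of_ne hx σ).smul (hasFDerivAt_id x) using 1
  ext v
  simp [smul_smul, mul_comm]

theorem norm_norm_rpow_smul {σ : ℝ} (hσ : σ + 1 ≠ 0) (x : E) :
    ‖‖x‖ ^ σ • x‖ = ‖x‖ ^ (σ + 1) := by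
  rw [norm_smul, Real.norm_of_nonneg (by positivity), Real.rpow_add_one' (norm_nonneg x) hσ]

theorem continuous_norm_rpow_smul {σ : ℝ} (hσ : -1 < σ) :
    Continuous fun y : E => ‖y‖ ^ σ • y := by
  refine continuous_iff_continuousAt.2 fun x => ?_
  by_cases hx : x = 0
  · subst hx
    rw [ContinuousAt, smul_zero, tendsto_zero_iff_norm_tendsto_zero]
    simp_rw [norm_norm_rpow_smul (show σ + 1 ≠ 0 by linarith)]
    have : ContinuousAt (fun y : E => ‖y‖ ^ (σ + 1)) 0 :=
      continuousAt_id.norm.rpow_const (.inr (by linarith))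
    simpa [ContinuousAt, show σ + 1 ≠ 0 by linarith] using this
  · exact (hasFDerivAt_norm_rpow_smul_of_ne hx σ).continuousAt

theorem hasFDerivAt_norm_rpow_smul_zero {σ : ℝ} (hσ : 0 < σ) :
    HasFDerivAt (fun y : E => ‖y‖ ^ σ • y) (0 : E →L[ℝ] E) 0 := by
  refine .of_isLittleO ?_
  simp only [smul_zero, sub_zero, zero_apply]
  have h : (fun y : E => ‖y‖ ^ σ) =o[nhds 0] fun _ => (1 : ℝ) := by
    refine (Asymptotics.isLittleO_const_iff one_ne_zero).2 ?_
    have : ContinuousAt (fun y : E => ‖y‖ ^ σ) 0 := continuousAt_id.norm.rpow_const (.inr hσ.le)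
    simpa [ContinuousAt, hσ.ne'] using this
  simpa using h.smul_isBigO (Asymptotics.isBigO_refl (fun y : E => y) (nhds 0))

/-- Only the origin is delicate: there the derivative is 0, and elsewhere its norm is at most
(1+σ)|y|^σ, which tends to 0. -/
theorem contDiff_norm_rpow_smul {σ : ℝ} (hσ : 0 < σ) :
    ContDiff ℝ 1 fun y : E => ‖y‖ ^ σ • y := by
  rw [contDiff_one_iff_fderiv]
  refine ⟨fun x => ?_, continuous_iff_continuousAt.2 fun x => ?_⟩
  · by_cases hx : x = 0
    · exact hx ▸ (hasFDerivAt_norm_rpow_smul_zero hσ).differentiableAt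
    · exact (hasFDerivAt_norm_rpow_smul_of_ne hx σ).differentiableAt
  · by_cases hx : x = 0
    · subst hx
      rw [ContinuousAt, (hasFDerivAt_norm_rpow_smul_zero hσ).fderiv,
        tendsto_zero_iff_norm_tendsto_zero]
      have h : Filter.Tendsto (fun y : E => (1 + σ) * ‖y‖ ^ σ) (nhds 0) (nhds 0) := by
        have : ContinuousAt (fun y : E => (1 + σ) * ‖y‖ ^ σ) 0 :=
          continuousAt_const.mul (continuousAt_id.norm.rpow_const (.inr hσ.le))
        simpa [ContinuousAt, hσ.ne'] using this
      refine squeeze_zero (fun _ => norm_nonneg _) (fun y => ?_) h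
      by_cases hy : y = 0
      · subst hy
        rw [(hasFDerivAt_norm_rpow_smul_zero hσ).fderiv, norm_zero]
        positivity
      · rw [(hasFDerivAt_norm_rpow_smul_of_ne hy σ).fderiv]
        have hy' : 0 < ‖y‖ := norm_pos_iff.2 hy
        refine (norm_add_le _ _).trans ?_
        rw [add_mul, one_mul]
        refine add_le_add ?_ ?_
        · rw [norm_smul, Real.norm_of_nonneg (by positivity)]
          exact mul_le_of_le_one_right (by positivity) ContinuousLinearMap.norm_id_le
        · rw [ContinuousLinearMap.norm_smulRight_apply, innerSL_apply_norm, norm_smul,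
            Real.norm_of_nonneg (by positivity)]
          apply le_of_eq
          have : ‖y‖ ^ σ = ‖y‖ ^ (σ - 2) * ‖y‖ ^ 2 := by
            rw [← Real.rpow_natCast, ← Real.rpow_add hy']
            norm_num
          rw [this]
          ring
    · have h : (fun y => fderiv ℝ (fun y : E => ‖y‖ ^ σ • y) y) =ᶠ[nhds x] fun y =>
          ‖y‖ ^ σ • ContinuousLinearMap.id ℝ E +
            (ContinuousLinearMap.smulRightL ℝ E E (innerSL ℝ y)) ((σ * ‖y‖ ^ (σ - 2)) • y) := by
        filter_upwards [isOpen_ne.mem_nhds hx] with y hy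
        exact (hasFDerivAt_norm_rpow_smul_of_ne hy σ).fderiv
      refine ContinuousAt.congr ?_ h.symm
      have h0 : ‖x‖ ≠ 0 := norm_ne_zero_iff.2 hx
      fun_prop (discharger := simp [hx])

theorem contDiff_two_norm_rpow {γ : ℝ} (hγ : 2 ≤ γ) : ContDiff ℝ 2 fun y : E => ‖y‖ ^ γ := by
  obtain rfl | hγ := hγ.eq_or_lt
  · simp only [Real.rpow_ofNat]
    exact contDiff_norm_sq ℝ
  · rw [show (2 : WithTop ℕ∞) = 1 + 1 by norm_num, contDiff_succ_iff_fderiv]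
    refine ⟨differentiable_norm_rpow (by linarith), by simp, ?_⟩
    have h : fderiv ℝ (fun y : E => ‖y‖ ^ γ) =
        fun y => γ • innerSL ℝ (‖y‖ ^ (γ - 2) • y) := by
      ext1 y
      rw [fderiv_norm_rpow y (by linarith), map_smul, smul_smul]
    rw [h]
    exact (((innerSL ℝ : E →L[ℝ] E →L[ℝ] ℝ).contDiff).comp
      (contDiff_norm_rpow_smul (E := E) (σ := γ - 2) (by linarith))).const_smul γ

end RadialField

/-- The radial function `C |x|^γ`. -/
def radialPower (n : ℕ) (C γ : ℝ) (x : RSpace n) : ℝ := C * ‖x‖ ^ γ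

variable {n : ℕ} {C γ : ℝ}

theorem contDiff_radialPower (hγ : 1 < γ) : ContDiff ℝ 1 (radialPower n C γ) :=
  contDiff_const.mul (contDiff_norm_rpow hγ)

theorem contDiff_two_radialPower (hγ : 2 ≤ γ) : ContDiff ℝ 2 (radialPower n C γ) :=
  contDiff_const.mul (contDiff_two_norm_rpow hγ)

theorem contDiffOn_radialPower : ContDiffOn ℝ 2 (radialPower n C γ) {0}ᶜ := fun x hx => by
  have hx' : x ≠ 0 := hx
  exact (contDiffAt_const.mul
    ((contDiffAt_norm ℝ hx').rpow_const_of_ne (norm_ne_zero_iff.2 hx'))).contDiffWithinAt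

theorem hasFDerivAt_radialPower (hγ : 1 < γ) (x : RSpace n) :
    HasFDerivAt (radialPower n C γ) ((C * γ) • innerSL ℝ (‖x‖ ^ (γ - 2) • x)) x := by
  refine ((hasFDerivAt_norm_rpow x hγ).const_mul C).congr_fderiv ?_
  rw [map_smul, smul_smul, smul_smul]
  ring_nf

theorem gradient_radialPower (hγ : 1 < γ) (x : RSpace n) :
    gradient (radialPower n C γ) x = (C * γ) • ‖x‖ ^ (γ - 2) • x := by
  refine HasGradientAt.gradient ?_
  rw [hasGradientAt_iff_hasFDerivAt]
  refine (hasFDerivAt_radialPower hγ x).congr_fderiv ?_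
  ext v
  simp

theorem norm_gradient_radialPower (hγ : 1 < γ) (hC : 0 ≤ C) (x : RSpace n) :
    ‖gradient (radialPower n C γ) x‖ = C * γ * ‖x‖ ^ (γ - 1) := by
  rw [gradient_radialPower hγ, norm_smul, norm_norm_rpow_smul (by linarith),
    Real.norm_of_nonneg (by positivity)]
  ring_nf

theorem pGradient_radialPower {p : ℝ} (hγ : 1 < γ) (hC : 0 < C) (x : RSpace n) :
    pGradient p (radialPower n C γ) x =
      (C * γ) ^ (p - 1) • ‖x‖ ^ ((γ - 1) * (p - 1) - 1) • x := by
  by_cases hx : x = 0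
  · simp [pGradient, gradient_radialPower hγ, hx]
  have hx' : 0 < ‖x‖ := norm_pos_iff.2 hx
  have hCγ : 0 < C * γ := by positivity
  rw [pGradient, norm_gradient_radialPower hγ hC.le, gradient_radialPower hγ, smul_smul, smul_smul,
    smul_smul, Real.mul_rpow hCγ.le (by positivity), ← Real.rpow_mul hx'.le]
  congr 1
  have h1 : (C * γ) ^ (p - 1) = (C * γ) ^ (p - 2) * (C * γ) := by
    rw [← Real.rpow_add_one hCγ.ne']
    ring_nf
  have h2 : ‖x‖ ^ ((γ - 1) * (p - 1) - 1) = ‖x‖ ^ ((γ - 1) * (p - 2)) * ‖x‖ ^ (γ - 2) := by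
    rw [← Real.rpow_add hx']
    ring_nf
  rw [h1, h2]
  ring

theorem hasFDerivAt_pGradient_radialPower {p : ℝ} (hγ : 1 < γ) (hC : 0 < C) {x : RSpace n}
    (hx : x ≠ 0) :
    HasFDerivAt (pGradient p (radialPower n C γ))
      (((C * γ) ^ (p - 1) * ‖x‖ ^ ((γ - 1) * (p - 1) - 1)) • ContinuousLinearMap.id ℝ _ +
        (innerSL ℝ x).smulRight (((C * γ) ^ (p - 1) * (((γ - 1) * (p - 1) - 1) *
          ‖x‖ ^ ((γ - 1) * (p - 1) - 1 - 2))) • x)) x := by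
  rw [funext fun x => pGradient_radialPower (p := p) hγ hC x]
  refine ((hasFDerivAt_norm_rpow_smul_of_ne hx ((γ - 1) * (p - 1) - 1)).const_smul
    ((C * γ) ^ (p - 1))).congr_fderiv ?_
  ext v
  simp [smul_smul]
  left
  ring

/-- For `F` at least the smallest eigenvalue, a suitable multiple of `|x|^γ` with
`γ = 1 + (α+1)/(p-1-β)` is an admissible subsolution for `f ≡ 1`. -/
theorem exists_isAdmissibleSubsolution_radialPower {K : Set (Fin (n + 1) → ℝ)}
    {F : (Fin (n + 1) → ℝ) → ℝ} {p α β : ℝ} (hp : 1 < p) (hα : -1 < α) (hβ : β < p - 1)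
    (hF : ∀ lam t, 0 < t → (∀ i, t ≤ lam i) → lam ∈ K ∧ t ≤ F lam) :
    ∃ C, 0 < C ∧ IsAdmissibleSubsolution K F p α β (fun t => Real.exp (0 * t))
      (radialPower (n + 1) C (1 + (α + 1) / (p - 1 - β))) := by
  have hb : 0 < p - 1 - β := by linarith
  set γ := 1 + (α + 1) / (p - 1 - β) with hγ
  have hγ0 : 0 < γ - 1 := by
    rw [hγ, add_sub_cancel_left]
    exact div_pos (by linarith) hb
  have hγ1 : 1 < γ := by linarith
  have hγe : (γ - 1) * (p - 1 - β) = α + 1 := by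
    rw [hγ, add_sub_cancel_left, div_mul_cancel₀ _ hb.ne']
  set m := (γ - 1) * (p - 1) with hm
  have hm0 : 0 < m := mul_pos hγ0 (by linarith)
  set θ := min 1 m with hθ
  have hθ0 : 0 < θ := lt_min one_pos hm0
  -- L stands for Cγ. It solves L^(p-1) θ = L^β, so the smallest eigenvalue equals the right-hand
  -- side of the equation.
  set L := (1 / θ) ^ (1 / (p - 1 - β)) with hL
  have hL0 : 0 < L := by positivity
  have hLe : L ^ (p - 1) * θ = L ^ β := by
    have h1 : L ^ (p - 1 - β) = 1 / θ := by
      rw [hL, ← Real.rpow_mul (by positivity), one_div_mul_cancel hb.ne', Real.rpow_one]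
    have h2 : L ^ (p - 1) = L ^ (p - 1 - β) * L ^ β := by
      rw [← Real.rpow_add hL0]
      ring_nf
    rw [h2, h1]
    field_simp
  have hC0 : 0 < L / γ := by positivity
  have hCγ : L / γ * γ = L := div_mul_cancel₀ _ (by linarith)
  refine ⟨L / γ, hC0, ⟨EuclideanSpace.single 0 1, 0, ?_⟩, fun x hx => ?_⟩
  · simp [radialPower, Real.zero_rpow (show γ ≠ 0 by linarith), hL0.ne', show γ ≠ 0 by linarith]
  have hx' : 0 < ‖x‖ := norm_pos_iff.2 hx
  have hd := hasFDerivAt_pGradient_radialPower (p := p) hγ1 hC0 hx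
  rw [hCγ, ← hm] at hd
  set a := L ^ (p - 1) * ‖x‖ ^ (m - 1) with ha
  have ha0 : 0 < a := by positivity
  have hpow : L ^ (p - 1) * ((m - 1) * ‖x‖ ^ (m - 1 - 2)) * ‖x‖ ^ 2 = (m - 1) * a := by
    have : ‖x‖ ^ (m - 1) = ‖x‖ ^ (m - 1 - 2) * ‖x‖ ^ 2 := by
      rw [← Real.rpow_natCast, ← Real.rpow_add hx']
      norm_num
    rw [ha, this]
    ring
  -- The radial direction carries the eigenvalue m a, all tangential directions the eigenvalue a.
  refine ⟨hd.differentiableAt, fun _ => ?_, fun i => if i = 0 then m * a else a, ?_, ?_⟩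
  · rw [← norm_pos_iff, norm_gradient_radialPower hγ1 hC0.le]
    positivity
  · rw [hd.fderiv]
    convert isEigenvalueVector_smul_id_add_smulRight a _ x using 1
    rw [hpow]
    ext i
    by_cases hi : i = 0
    · simp [hi]
      ring
    · simp [hi]
  · have hmain := hF (fun i => if i = 0 then m * a else a) (θ * a) (by positivity) fun i => by
      split_ifs
      · exact mul_le_mul_of_nonneg_right (min_le_right _ _) ha0.le
      · exact mul_le_of_le_one_left ha0.le (min_le_left _ _)
    refine ⟨hmain.1, le_trans (le_of_eq ?_) hmain.2⟩
    simp only [zero_mul, Real.exp_zero, mul_one]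
    rw [norm_gradient_radialPower hγ1 hC0.le, hCγ,
      Real.mul_rpow hL0.le (by positivity), ← Real.rpow_mul hx'.le, ← hLe, ha]
    have : ‖x‖ ^ (m - 1) = ‖x‖ ^ α * ‖x‖ ^ ((γ - 1) * β) := by
      rw [← Real.rpow_add hx']
      congr 1
      rw [hm]
      linarith [hγe]
    rw [this]
    ring
end

/-! ### Divergence theorems for fields that are not differentiable at the origin. -/

noncomputable section
open MeasureTheory Set

theorem lt_norm_toLp_of_notMem_Icc {n : ℕ} {ρ : ℝ} {y : Fin n → ℝ}
    (hy : y ∉ Icc (fun _ => -ρ) (fun _ => ρ)) : ρ < ‖(WithLp.toLp 2 y : RSpace n)‖ := by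
  by_contra! h
  refine hy ⟨fun i => ?_, fun i => ?_⟩ <;>
  have := (PiLp.norm_apply_le (WithLp.toLp 2 y : RSpace n) i).trans h
  · exact (abs_le.1 this).1
  · exact (abs_le.1 this).2

theorem integral_eq_setIntegral_Icc {n : ℕ} {ρ : ℝ} {G : RSpace n → ℝ}
    (hG : ∀ x, ρ < ‖x‖ → G x = 0) :
    ∫ x, G x = ∫ y in Icc (fun _ => -ρ) (fun _ => ρ), G (WithLp.toLp 2 y) := by
  rw [setIntegral_eq_integral_of_forall_compl_eq_zero fun y hy => hG _ (lt_norm_toLp_of_notMem_Icc hy)]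
  exact ((PiLp.volume_preserving_toLp (Fin n)).integral_comp
    (MeasurableEquiv.toLp 2 (Fin n → ℝ)).measurableEmbedding G).symm

theorem le_norm_toLp_insertNth {n : ℕ} (i : Fin (n + 1)) {t ρ : ℝ} (ht : ρ ≤ |t|)
    (y : Fin n → ℝ) : ρ ≤ ‖(WithLp.toLp 2 (i.insertNth t y : Fin (n + 1) → ℝ) : RSpace (n + 1))‖ := by
  have := PiLp.norm_apply_le (WithLp.toLp 2 (i.insertNth t y : Fin (n + 1) → ℝ) : RSpace (n + 1)) i
  simp only [Fin.insertNth_apply_same, Real.norm_eq_abs] at this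
  exact ht.trans this

/-- For continuous g the box integral is the Lebesgue integral, and box integrals are monotone; no
Lebesgue integrability of f is needed. -/
theorem setIntegral_le_of_hasIntegral {ι : Type} [Fintype ι] {I : BoxIntegral.Box ι}
    {l : BoxIntegral.IntegrationParams} {f g : (ι → ℝ) → ℝ} {y : ℝ}
    (hf : BoxIntegral.HasIntegral I l f BoxIntegral.BoxAdditiveMap.volume y)
    (hg : Continuous g) (hgf : ∀ x ∈ BoxIntegral.Box.Icc I, g x ≤ f x) :
    ∫ x in BoxIntegral.Box.Icc I, g x ≤ y := by
  have hGi := ContinuousOn.hasBoxIntegral (I := I) volume hg.continuousOn l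
  rw [setIntegral_congr_set (BoxIntegral.Box.coe_ae_eq_Icc I)] at hGi
  have hsub := (hf.sub hGi).integral_eq
  have := BoxIntegral.integral_nonneg (I := I) (l := l) (g := f - g)
    (fun x hx => sub_nonneg.2 (hgf x hx)) volume
  exact sub_nonneg.1 (this.trans_eq hsub)

/-- A lower bound of the divergence of a compactly supported continuous field, differentiable off
the origin, has nonpositive integral; the divergence itself need not be integrable. -/
theorem integral_le_of_le_divergence {n : ℕ} {V : RSpace (n + 1) → RSpace (n + 1)}
    {V' : RSpace (n + 1) → RSpace (n + 1) →L[ℝ] RSpace (n + 1)} {ρ E : ℝ}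
    {G : RSpace (n + 1) → ℝ} (hρ : 0 < ρ) (hV : Continuous V)
    (hV' : ∀ x, x ≠ 0 → HasFDerivAt V (V' x) x) (hV0 : ∀ x, ρ ≤ ‖x‖ → V x = 0)
    (hG : Continuous G) (hG0 : ∀ x, ρ ≤ ‖x‖ → G x = 0)
    (hle : ∀ x, x ≠ 0 → G x - E ≤ ∑ i, V' x (EuclideanSpace.single i 1) i) :
    ∫ x, G x ≤ E * (2 * ρ) ^ (n + 1) := by
  let e : RSpace (n + 1) ≃L[ℝ] (Fin (n + 1) → ℝ) :=
    PiLp.continuousLinearEquiv 2 ℝ fun _ : Fin (n + 1) => ℝ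
  let I : BoxIntegral.Box (Fin (n + 1)) := ⟨fun _ => -ρ, fun _ => ρ, fun _ => by simpa using hρ⟩
  have hI : BoxIntegral.Box.Icc I = Icc (fun _ => -ρ) (fun _ => ρ) := rfl
  let f : (Fin (n + 1) → ℝ) → Fin (n + 1) → ℝ := fun y => e (V (e.symm y))
  -- The value at the exceptional point 0 is free; this multiple of the identity has trace at least
  -- G 0 - E, so the lower bound holds at every point of the box.
  let f' : (Fin (n + 1) → ℝ) → (Fin (n + 1) → ℝ) →L[ℝ] (Fin (n + 1) → ℝ) := fun y =>
    if y = 0 then |G 0 - E| • ContinuousLinearMap.id ℝ _ else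
      (e : RSpace (n + 1) →L[ℝ] (Fin (n + 1) → ℝ)) ∘L V' (e.symm y) ∘L
        (e.symm : (Fin (n + 1) → ℝ) →L[ℝ] RSpace (n + 1))
  have hf : Continuous f := e.continuous.comp (hV.comp e.symm.continuous)
  have hf' : ∀ y, y ≠ 0 → HasFDerivAt f (f' y) y := fun y hy => by
    simp only [f', if_neg hy]
    exact e.hasFDerivAt.comp y ((hV' (e.symm y) (by simpa using hy)).comp y e.symm.hasFDerivAt)
  -- The `GP` integral of a divergence always exists, even with a countable exceptional set, and
  -- equals the boundary terms; these vanish because every face lies in ‖x‖ ≥ ρ.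
  have hdiv := BoxIntegral.hasIntegral_GP_divergence_of_forall_hasDerivWithinAt I f f' {0}
    (countable_singleton 0) (fun x _ => hf.continuousWithinAt)
    fun x hx => (hf' x hx.2).hasFDerivWithinAt
  have hface : ∀ i : Fin (n + 1), ∀ t : ℝ, ρ ≤ |t| →
      (fun y : Fin n → ℝ => f (i.insertNth t y) i) = fun _ => 0 := fun i t ht => by
    ext y
    have : V (e.symm (i.insertNth t y)) = 0 := hV0 _ (le_norm_toLp_insertNth i ht y)
    simp [f, this]
  have hzero : ∑ i : Fin (n + 1),
      (BoxIntegral.integral (I.face i) BoxIntegral.IntegrationParams.GP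
        (fun x => f (i.insertNth (I.upper i) x) i) BoxIntegral.BoxAdditiveMap.volume -
      BoxIntegral.integral (I.face i) BoxIntegral.IntegrationParams.GP
        (fun x => f (i.insertNth (I.lower i) x) i) BoxIntegral.BoxAdditiveMap.volume) = 0 := by
    refine Finset.sum_eq_zero fun i _ => ?_
    rw [hface i (I.upper i) (le_abs_self ρ), hface i (I.lower i) ((le_abs_self ρ).trans_eq
      (abs_neg ρ).symm), sub_self]
  rw [hzero] at hdiv
  have hGc : Continuous fun y : Fin (n + 1) → ℝ => G (e.symm y) - E :=
    (hG.comp e.symm.continuous).sub continuous_const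
  have hpos := setIntegral_le_of_hasIntegral hdiv hGc fun y _ => by
    simp only [f']
    by_cases hy : y = 0
    · subst hy
      simp only [if_pos, map_zero]
      simp only [smul_apply, ContinuousLinearMap.id_apply, Pi.smul_apply,
        Pi.single_eq_same, smul_eq_mul, mul_one, Finset.sum_const, Finset.card_univ,
        Fintype.card_fin, nsmul_eq_mul]
      refine (le_abs_self _).trans (le_mul_of_one_le_left (abs_nonneg _) ?_)
      push_cast
      linarith [(Nat.cast_nonneg n : (0 : ℝ) ≤ n)]
    · simp only [if_neg hy]
      exact hle (e.symm y) (by simpa using hy)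
  have hGe : Continuous fun y : Fin (n + 1) → ℝ => G (e.symm y) := hG.comp e.symm.continuous
  rw [hI, integral_sub hGe.continuousOn.integrableOn_Icc
    (continuousOn_const.integrableOn_Icc), setIntegral_const] at hpos
  rw [integral_eq_setIntegral_Icc fun x hx => hG0 x hx.le]
  have hvol : (volume : Measure (Fin (n + 1) → ℝ)).real (Icc (fun _ => -ρ) (fun _ => ρ)) =
      (2 * ρ) ^ (n + 1) := by
    rw [measureReal_def, Real.volume_Icc_pi_toReal fun _ => by linarith]
    simp [two_mul]
  rw [hvol, smul_eq_mul] at hpos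
  have : ∀ y, e.symm y = WithLp.toLp 2 y := fun _ => rfl
  simp only [this] at hpos
  linarith

/-- This is the divergence theorem for the field whose only nonzero component is V in direction j.
-/
theorem integral_fderiv_single_eq_zero {n : ℕ} {V : RSpace (n + 1) → ℝ}
    {V' : RSpace (n + 1) → RSpace (n + 1) →L[ℝ] ℝ} {ρ : ℝ} (hρ : 0 < ρ) (hV : Continuous V)
    (hV' : ∀ x, x ≠ 0 → HasFDerivAt V (V' x) x) (hV0 : ∀ x, ρ ≤ ‖x‖ → V x = 0)
    (j : Fin (n + 1)) (hi : Integrable fun x => V' x (EuclideanSpace.single j 1)) :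
    ∫ x, V' x (EuclideanSpace.single j 1) = 0 := by
  have hout : ∀ x, ρ < ‖x‖ → V' x (EuclideanSpace.single j 1) = 0 := fun x hx => by
    have h0 : V =ᶠ[nhds x] fun _ => 0 := by
      filter_upwards [continuous_norm.continuousAt.eventually (lt_mem_nhds hx)] with y hy
      exact hV0 y (le_of_lt hy)
    have hx0 : x ≠ 0 := norm_pos_iff.1 (hρ.trans hx)
    rw [(hV' x hx0).unique ((hasFDerivAt_const (0 : ℝ) x).congr_of_eventuallyEq h0)]
    simp
  let e : RSpace (n + 1) ≃L[ℝ] (Fin (n + 1) → ℝ) :=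
    PiLp.continuousLinearEquiv 2 ℝ fun _ : Fin (n + 1) => ℝ
  rw [integral_eq_setIntegral_Icc hout]
  have hsum : ∀ y : Fin (n + 1) → ℝ, V' (WithLp.toLp 2 y) (EuclideanSpace.single j 1) =
      ∑ i, (if i = j then V' (e.symm y) ∘L
        (e.symm : (Fin (n + 1) → ℝ) →L[ℝ] RSpace (n + 1)) else 0) (Pi.single i 1) := fun y => by
    rw [Finset.sum_eq_single j (fun i _ hij => by simp [hij]) (by simp)]
    simp only [if_pos]
    rfl
  have hVe : Continuous fun y => V (e.symm y) := hV.comp e.symm.continuous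
  have hint : Integrable fun y : Fin (n + 1) → ℝ =>
      V' (WithLp.toLp 2 y) (EuclideanSpace.single j 1) :=
    ((PiLp.volume_preserving_toLp (Fin (n + 1))).integrable_comp_emb
      (MeasurableEquiv.toLp 2 (Fin (n + 1) → ℝ)).measurableEmbedding).2 hi
  simp_rw [hsum] at hint ⊢
  rw [integral_divergence_of_hasFDerivAt_off_countable' (fun _ => -ρ) (fun _ => ρ)
    (fun _ => by linarith) (fun i y => if i = j then V (e.symm y) else 0) _ {0}
    (countable_singleton 0) ?_ ?_ hint.integrableOn]
  · refine Finset.sum_eq_zero fun i _ => ?_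
    have hface : ∀ t : ℝ, ρ ≤ |t| → ∀ y : Fin n → ℝ, V (e.symm (i.insertNth t y)) = 0 :=
      fun t ht y => hV0 _ (le_norm_toLp_insertNth i ht y)
    simp [hface ρ (le_abs_self ρ), hface (-ρ) ((le_abs_self ρ).trans_eq (abs_neg ρ).symm)]
  · intro i
    split_ifs
    · exact hVe.continuousOn
    · exact continuousOn_const
  · intro y hy i
    split_ifs
    · exact (hV' (e.symm y) (by simpa using hy.2)).comp y e.symm.hasFDerivAt
    · exact hasFDerivAt_const _ _

/-- Integration by parts against a test function for a continuous function that is differentiable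
off the origin with locally integrable derivative. -/
theorem isWeakPartial_of_hasFDerivAt {n : ℕ} {f : RSpace (n + 1) → ℝ}
    {f' : RSpace (n + 1) → RSpace (n + 1) →L[ℝ] ℝ} (hf : Continuous f)
    (hf' : ∀ x, x ≠ 0 → HasFDerivAt f (f' x) x) (j : Fin (n + 1))
    (hi : LocallyIntegrable fun x => f' x (EuclideanSpace.single j 1)) :
    IsWeakPartial j f fun x => f' x (EuclideanSpace.single j 1) := by
  intro φ hφ hφc
  have hφ1 : Differentiable ℝ φ := hφ.differentiable (by simp)
  have hφ2 : Continuous (fun x => fderiv ℝ φ x (EuclideanSpace.single j 1)) :=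
    (hφ.continuous_fderiv (by simp)).clm_apply continuous_const
  obtain ⟨ρ, hρ⟩ := hφc.isCompact.isBounded.exists_norm_le
  have hzero : ∀ x, |ρ| + 1 ≤ ‖x‖ → φ x = 0 := fun x hx => by
    by_contra h
    have := hρ x (subset_tsupport φ h)
    linarith [le_abs_self ρ]
  have hi1 : Integrable fun x => f x * fderiv ℝ φ x (EuclideanSpace.single j 1) :=
    (hf.mul hφ2).integrable_of_hasCompactSupport
      ((hφc.fderiv_apply (𝕜 := ℝ) (EuclideanSpace.single j 1)).mul_left)
  have hi2 : Integrable fun x => f' x (EuclideanSpace.single j 1) * φ x := by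
    have := hi.integrable_smul_right_of_hasCompactSupport hφ.continuous hφc
    simpa only [smul_eq_mul] using this
  have h := integral_fderiv_single_eq_zero (V := fun x => f x * φ x)
    (V' := fun x => f x • fderiv ℝ φ x + φ x • f' x) (ρ := |ρ| + 1) (by positivity)
    (hf.mul hφ.continuous) (fun x hx => (hf' x hx).mul (hφ1 x).hasFDerivAt)
    (fun x hx => by simp [hzero x hx]) j
    ((hi1.add hi2).congr (ae_of_all _ fun x => by simp [mul_comm]))
  have h2 : ∫ x, (f x * fderiv ℝ φ x (EuclideanSpace.single j 1) +
      f' x (EuclideanSpace.single j 1) * φ x) = 0 := by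
    rw [← h]
    exact integral_congr_ae (ae_of_all _ fun x => by simp [mul_comm])
  rw [integral_add hi1 hi2] at h2
  linarith

end

/-! ### Local Sobolev regularity of radial powers. -/

noncomputable section
open MeasureTheory Set

theorem integrableOn_norm_rpow_ball {n : ℕ} {τ : ℝ} (hτ : -1 < τ) {R : ℝ} (hR : 0 < R) :
    IntegrableOn (fun x : RSpace (n + 1) => ‖x‖ ^ τ) (Metric.ball 0 R) := by
  have h1 : (Metric.ball (0 : RSpace (n + 1)) R).indicator (fun x => ‖x‖ ^ τ) =
      fun x => (Iio R).indicator (fun r : ℝ => r ^ τ) ‖x‖ := by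
    ext x
    simp [indicator]
  -- Polar coordinates reduce the claim to r^(n+τ) on (0, R), whose exponent exceeds -1.
  rw [← integrable_indicator_iff Metric.isOpen_ball.measurableSet, h1,
    integrable_fun_norm_addHaar volume (f := (Iio R).indicator (fun r : ℝ => r ^ τ))]
  have h2 : IntegrableOn (fun r : ℝ => r ^ (n + τ)) (Ioo 0 R) :=
    (intervalIntegral.integrableOn_Ioo_rpow_iff hR).2
      (by linarith [(Nat.cast_nonneg n : (0 : ℝ) ≤ n)])
  have h3 : (fun y : ℝ => y ^ (Module.finrank ℝ (RSpace (n + 1)) - 1) •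
      (Iio R).indicator (fun r : ℝ => r ^ τ) y) =
      (Iio R).indicator fun y : ℝ => y ^ n * y ^ τ := by
    ext y
    simp [indicator]
  rw [h3, IntegrableOn, integrable_indicator_iff measurableSet_Iio, IntegrableOn,
    Measure.restrict_restrict measurableSet_Iio, inter_comm, Ioi_inter_Iio]
  refine h2.congr_fun (fun r hr => ?_) measurableSet_Ioo
  simp only
  rw [Real.rpow_add hr.1, Real.rpow_natCast]

theorem memLpLocal_norm_rpow {n : ℕ} {σ δ : ℝ} (hδ : 0 < δ) (hσ : -1 < σ * δ) :
    MemLpLocal δ fun x : RSpace (n + 1) => ‖x‖ ^ σ := by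
  intro K hK
  obtain ⟨R, hR0, hR⟩ := hK.isBounded.subset_ball_lt 0 0
  rw [← integrable_norm_rpow_iff (Measurable.aestronglyMeasurable (by fun_prop)) (by simpa using hδ) ENNReal.ofReal_ne_top,
    ENNReal.toReal_ofReal hδ.le]
  refine ((integrableOn_norm_rpow_ball hσ hR0).mono_set hR).congr (ae_of_all _ fun x => ?_)
  simp only [Real.norm_of_nonneg (Real.rpow_nonneg (norm_nonneg x) σ)]
  rw [Real.rpow_mul (norm_nonneg x)]

theorem memLpLocal_of_continuous {n : ℕ} {f : RSpace n → ℝ} (hf : Continuous f) (δ : ℝ) :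
    MemLpLocal δ f := by
  intro K hK
  obtain ⟨B, hB⟩ := hK.exists_bound_of_continuousOn hf.continuousOn
  have : IsFiniteMeasure (volume.restrict K) := ⟨by simpa using hK.measure_lt_top⟩
  exact MemLp.of_bound hf.aestronglyMeasurable B
    ((ae_restrict_iff' hK.measurableSet).2 (ae_of_all _ hB))

theorem MemLpLocal.locallyIntegrable {n : ℕ} {f : RSpace n → ℝ} {δ : ℝ} (hδ : 1 ≤ δ)
    (hf : MemLpLocal δ f) : LocallyIntegrable f := by
  refine locallyIntegrable_iff.2 fun K hK => ?_
  have : IsFiniteMeasure (volume.restrict K) := ⟨by simpa using hK.measure_lt_top⟩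
  exact (hf K hK).integrable (by simpa using ENNReal.ofReal_le_ofReal hδ)

theorem memSobolevTwoLocal_radialPower {n : ℕ} {C γ δ : ℝ} (hγ : 1 < γ) (hδ : 1 ≤ δ)
    (hγδ : -1 < (γ - 2) * δ) : MemSobolevTwoLocal δ (radialPower (n + 1) C γ) := by
  let u' : RSpace (n + 1) → RSpace (n + 1) →L[ℝ] ℝ := fun x =>
    (C * γ) • innerSL ℝ (‖x‖ ^ (γ - 2) • x)
  let D : RSpace (n + 1) → RSpace (n + 1) →L[ℝ] RSpace (n + 1) := fun x =>
    ‖x‖ ^ (γ - 2) • ContinuousLinearMap.id ℝ _ +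
        (innerSL ℝ x).smulRight (((γ - 2) * ‖x‖ ^ (γ - 2 - 2)) • x)
  let g : Fin (n + 1) → RSpace (n + 1) → ℝ := fun i x => u' x (EuclideanSpace.single i 1)
  have hg : ∀ i x, g i x = (C * γ) * (‖x‖ ^ (γ - 2) • x) i := fun i x => by
    simp [g, u', EuclideanSpace.inner_single_right]
  let g' : Fin (n + 1) → RSpace (n + 1) → RSpace (n + 1) →L[ℝ] ℝ := fun i x =>
    (C * γ) • (EuclideanSpace.proj i ∘L D x)
  have hu : Continuous (radialPower (n + 1) C γ) := (contDiff_radialPower hγ).continuous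
  have hgc : ∀ i, Continuous (g i) := fun i => by
    rw [funext (hg i)]
    exact continuous_const.mul ((EuclideanSpace.proj (𝕜 := ℝ) i).continuous.comp
      (continuous_norm_rpow_smul (E := RSpace (n + 1)) (σ := γ - 2) (by linarith)))
  have hg' : ∀ i x, x ≠ 0 → HasFDerivAt (g i) (g' i x) x := fun i x hx => by
    rw [funext (hg i)]
    exact ((EuclideanSpace.proj (𝕜 := ℝ) i).hasFDerivAt.comp x
      (hasFDerivAt_norm_rpow_smul_of_ne hx (γ - 2))).const_mul (C * γ)
  have hform : ∀ i j x, g' i x (EuclideanSpace.single j 1) =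
      C * γ * (‖x‖ ^ (γ - 2) * (if i = j then 1 else 0) +
        (γ - 2) * ‖x‖ ^ (γ - 2 - 2) * (x j * x i)) := fun i j x => by
    simp only [g', D]
    simp [EuclideanSpace.inner_single_right]
    split_ifs <;> ring
  have hh : ∀ i j, MemLpLocal δ fun x => g' i x (EuclideanSpace.single j 1) := fun i j K hK => by
    have hmeas : Measurable fun x => g' i x (EuclideanSpace.single j 1) := by
      rw [funext (hform i j)]
      fun_prop
    -- Every second derivative is at most |Cγ|(1 + |γ-2|)|x|^(γ-2) in absolute value, since |x_i
    -- x_j| ≤ |x|².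
    refine ((memLpLocal_norm_rpow (by linarith) hγδ K hK).const_mul
      (|C * γ| * (1 + |γ - 2|))).mono hmeas.aestronglyMeasurable (ae_of_all _ fun x => ?_)
    rw [hform, norm_mul (C * γ), norm_mul (|C * γ| * (1 + |γ - 2|)), Real.norm_eq_abs (C * γ),
      Real.norm_of_nonneg (show 0 ≤ |C * γ| * (1 + |γ - 2|) by positivity),
      Real.norm_of_nonneg (show 0 ≤ ‖x‖ ^ (γ - 2) by positivity), mul_assoc |C * γ|]
    refine mul_le_mul_of_nonneg_left ((norm_add_le _ _).trans ?_) (abs_nonneg _)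
    rw [add_mul, one_mul]
    refine add_le_add ?_ ?_
    · rw [norm_mul, Real.norm_of_nonneg (show 0 ≤ ‖x‖ ^ (γ - 2) by positivity)]
      refine mul_le_of_le_one_right (by positivity) ?_
      split_ifs <;> simp
    · rw [norm_mul, norm_mul, norm_mul, Real.norm_eq_abs (γ - 2), mul_assoc]
      refine mul_le_mul_of_nonneg_left ?_ (abs_nonneg _)
      rw [Real.norm_of_nonneg (show 0 ≤ ‖x‖ ^ (γ - 2 - 2) by positivity)]
      by_cases hx : x = 0
      · simp [hx]
        positivity
      have hx' : 0 < ‖x‖ := norm_pos_iff.2 hx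
      calc ‖x‖ ^ (γ - 2 - 2) * (‖x j‖ * ‖x i‖) ≤ ‖x‖ ^ (γ - 2 - 2) * (‖x‖ * ‖x‖) := by
            gcongr <;> exact PiLp.norm_apply_le x _
        _ = ‖x‖ ^ (γ - 2) := by
            rw [← sq, ← Real.rpow_natCast, ← Real.rpow_add hx']
            norm_num
  refine ⟨memLpLocal_of_continuous hu δ, g, fun i j x => g' i x (EuclideanSpace.single j 1),
    fun i => ⟨memLpLocal_of_continuous (hgc i) δ, ?_⟩, fun i j => ⟨hh i j, ?_⟩⟩
  · exact isWeakPartial_of_hasFDerivAt hu (fun x _ => hasFDerivAt_radialPower hγ x) i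
      (hgc i).locallyIntegrable
  · exact isWeakPartial_of_hasFDerivAt (hgc i) (hg' i) j ((hh i j).locallyIntegrable hδ)

end

/-! ### The tested inequality: p-gradient, Young absorption and cutoffs. -/

noncomputable section
open MeasureTheory Set Filter Topology

theorem continuous_gradient {n : ℕ} {u : RSpace n → ℝ} (hu : ContDiff ℝ 1 u) :
    Continuous (gradient u) :=
  (InnerProductSpace.toDual ℝ (RSpace n)).symm.continuous.comp
    (hu.continuous_fderiv one_ne_zero)

theorem continuous_pGradient {n : ℕ} {p : ℝ} (hp : 1 < p) {u : RSpace n → ℝ}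
    (hu : ContDiff ℝ 1 u) : Continuous (pGradient p u) :=
  (continuous_norm_rpow_smul (σ := p - 2) (by linarith)).comp (continuous_gradient hu)

theorem norm_pGradient {n : ℕ} {p : ℝ} (hp : 1 < p) (u : RSpace n → ℝ) (x : RSpace n) :
    ‖pGradient p u x‖ = ‖gradient u x‖ ^ (p - 1) := by
  rw [pGradient, norm_norm_rpow_smul (by linarith)]
  ring_nf

theorem fderiv_apply_pGradient {n : ℕ} {p : ℝ} (hp : 1 < p) (u : RSpace n → ℝ) (x : RSpace n) :
    fderiv ℝ u x (pGradient p u x) = ‖gradient u x‖ ^ p := by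
  have h : fderiv ℝ u x = InnerProductSpace.toDual ℝ (RSpace n) (gradient u x) := by
    simp [gradient]
  rw [h, InnerProductSpace.toDual_apply_apply, pGradient, inner_smul_right,
    real_inner_self_eq_norm_sq]
  obtain h0 | h0 := (norm_nonneg (gradient u x)).eq_or_lt
  · rw [← h0, Real.zero_rpow (show p ≠ 0 by linarith)]
    simp
  · rw [← Real.rpow_natCast, ← Real.rpow_add h0]
    norm_num

/-- The three-term Young inequality by which the cutoff term is absorbed. -/
theorem young_absorption {p α β c s c₀ a b e : ℝ} {N : ℕ} (hc₀ : 0 < c₀) (hs : 0 < s)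
    (ha : 0 < a) (hb : 0 < b) (he : 0 < e) (habe : a + b + e = 1)
    (hgrad : a * β + b * p = p - 1) (hexp : a * (c + s) + b * s = s) (hN : 1 ≤ N * e) (hN1 : 1 ≤ N)
    {r G u φ q : ℝ} (hr : 0 < r) (hG : 0 < G) (hφ : 0 < φ) (hφ1 : φ ≤ 1) (hq : 0 ≤ q) :
    Real.exp (s * u) * (N * φ ^ (N - 1) * (q * G ^ (p - 1))) ≤
      c₀ * (r ^ α * G ^ β * Real.exp (c * u)) * (Real.exp (s * u) * φ ^ N) +
      s / 2 * (G ^ p * Real.exp (s * u) * φ ^ N) +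
      e * (N * (a / c₀) ^ a * (2 * b / s) ^ b * (q * r ^ (-(α * a)))) ^ (1 / e) := by
  set A := r ^ α * G ^ β * Real.exp (c * u) * (Real.exp (s * u) * φ ^ N) with hA
  set B := G ^ p * Real.exp (s * u) * φ ^ N with hB
  set κ := N * (a / c₀) ^ a * (2 * b / s) ^ b with hκ
  have hκ0 : 0 ≤ κ := by positivity
  have hA0 : 0 < A := by positivity
  have hB0 : 0 < B := by positivity
  have hQ0 : 0 ≤ κ * (q * r ^ (-(α * a))) := by positivity
  -- The factors are scaled so that the weighted terms are exactly c₀ A, (s/2) B and the error; κ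
  -- cancels the resulting constants. The relations `hgrad` and `hexp` match the powers of |Du| and
  -- of e^u.
  have key := Real.geom_mean_le_arith_mean3_weighted (p₁ := c₀ / a * A) (p₂ := s / (2 * b) * B)
    (p₃ := (κ * (q * r ^ (-(α * a)))) ^ (1 / e)) ha.le hb.le he.le (by positivity) (by positivity)
    (by positivity) habe
  have h1 : a * (c₀ / a * A) = c₀ * A := by field_simp
  have h2 : b * (s / (2 * b) * B) = s / 2 * B := by field_simp
  rw [h1, h2] at key
  refine le_trans ?_ (key.trans_eq (by rw [hA]; ring))
  have hAa : A ^ a = r ^ (α * a) * G ^ (β * a) * Real.exp ((c + s) * u * a) * φ ^ (N * a) := by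
    rw [hA, Real.mul_rpow (by positivity) (by positivity), Real.mul_rpow (by positivity)
      (by positivity), Real.mul_rpow (by positivity) (by positivity), Real.mul_rpow (by positivity)
      (by positivity), ← Real.rpow_mul hr.le, ← Real.rpow_mul hG.le, ← Real.exp_mul, ← Real.exp_mul,
      ← Real.rpow_natCast, ← Real.rpow_mul hφ.le]
    have : Real.exp ((c + s) * u * a) = Real.exp (c * u * a) * Real.exp (s * u * a) := by
      rw [← Real.exp_add]
      ring_nf
    rw [this]
    ring
  have hBb : B ^ b = G ^ (p * b) * Real.exp (s * u * b) * φ ^ (N * b) := by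
    rw [hB, Real.mul_rpow (by positivity) (by positivity), Real.mul_rpow (by positivity)
      (by positivity), ← Real.rpow_mul hG.le, ← Real.exp_mul,
      ← Real.rpow_natCast, ← Real.rpow_mul hφ.le]
  have hconst : (c₀ / a) ^ a * (s / (2 * b)) ^ b * κ = N := by
    have h3 : (c₀ / a) ^ a * (a / c₀) ^ a = 1 := by
      rw [← Real.mul_rpow (by positivity) (by positivity), div_mul_div_cancel₀ ha.ne',
        div_self hc₀.ne', Real.one_rpow]
    have h4 : (s / (2 * b)) ^ b * (2 * b / s) ^ b = 1 := by
      rw [← Real.mul_rpow (by positivity) (by positivity), div_mul_div_cancel₀ (by positivity),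
        div_self hs.ne', Real.one_rpow]
    calc (c₀ / a) ^ a * (s / (2 * b)) ^ b * κ
        = N * ((c₀ / a) ^ a * (a / c₀) ^ a) * ((s / (2 * b)) ^ b * (2 * b / s) ^ b) := by
          rw [hκ]; ring
      _ = N := by rw [h3, h4]; ring
  have hr1 : r ^ (α * a) * r ^ (-(α * a)) = 1 := by
    rw [← Real.rpow_add hr]
    simp
  have hG1 : G ^ (β * a) * G ^ (p * b) = G ^ (p - 1) := by
    rw [← Real.rpow_add hG, ← hgrad]
    ring_nf
  have hu1 : Real.exp ((c + s) * u * a) * Real.exp (s * u * b) = Real.exp (s * u) := by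
    rw [← Real.exp_add]
    congr 1
    linear_combination u * hexp
  -- As 0 < φ ≤ 1, this says N - 1 ≥ N(a+b) = N - Ne, which is the purpose of `hN`.
  have hφ2 : φ ^ (N - 1) ≤ φ ^ (N * a) * φ ^ (N * b) := by
    rw [← Real.rpow_add hφ, ← Real.rpow_natCast, Nat.cast_sub hN1]
    refine Real.rpow_le_rpow_of_exponent_ge hφ hφ1 ?_
    have : (N : ℝ) * a + N * b = N - N * e := by linear_combination (N : ℝ) * habe
    rw [this]
    push_cast
    linarith
  rw [Real.mul_rpow (by positivity) hA0.le, Real.mul_rpow (by positivity) hB0.le,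
    ← Real.rpow_mul hQ0, one_div_mul_cancel he.ne', Real.rpow_one, hAa, hBb]
  calc Real.exp (s * u) * (N * φ ^ (N - 1) * (q * G ^ (p - 1)))
      ≤ Real.exp (s * u) * (N * (φ ^ (N * a) * φ ^ (N * b)) * (q * G ^ (p - 1))) := by gcongr
    _ = ((c₀ / a) ^ a * (s / (2 * b)) ^ b * κ) * (r ^ (α * a) * r ^ (-(α * a))) *
        (G ^ (β * a) * G ^ (p * b)) * (Real.exp ((c + s) * u * a) * Real.exp (s * u * b)) *
        (φ ^ (N * a) * φ ^ (N * b)) * q := by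
          rw [hconst, hr1, hG1, hu1]; ring
    _ = _ := by ring

/-- Lower bound of `div (e^{su} φ^N |Du|^{p-2} Du)` for a cutoff function `φ`. -/
theorem le_divergence_of_trace {n : ℕ} {p α β c s c₀ a b e : ℝ} {N : ℕ} (hp : 1 < p)
    (hc₀ : 0 < c₀) (hs : 0 < s)
    (ha : 0 < a) (hb : 0 < b) (he : 0 < e) (habe : a + b + e = 1)
    (hgrad : a * β + b * p = p - 1) (hexp : a * (c + s) + b * s = s) (hN : 1 ≤ N * e) (hN2 : 2 ≤ N)
    {u φ : RSpace n → ℝ} {x : RSpace n} (hx : x ≠ 0) (hφ : 0 ≤ φ x) (hφ1 : φ x ≤ 1)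
    {T : RSpace n →L[ℝ] RSpace n}
    (htr : c₀ * (‖x‖ ^ α * ‖gradient u x‖ ^ β * Real.exp (c * u x)) ≤
      ∑ i, T (EuclideanSpace.single i 1) i)
    {E : ℝ} (hE : e * (N * (a / c₀) ^ a * (2 * b / s) ^ b *
      (‖fderiv ℝ φ x‖ * ‖x‖ ^ (-(α * a)))) ^ (1 / e) ≤ E) :
    s / 2 * (‖gradient u x‖ ^ p * Real.exp (s * u x) * φ x ^ N) - E ≤
      Real.exp (s * u x) * φ x ^ N * ∑ i, T (EuclideanSpace.single i 1) i +
      (Real.exp (s * u x) * φ x ^ N * s * fderiv ℝ u x (pGradient p u x) +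
        Real.exp (s * u x) * (N * φ x ^ (N - 1) * fderiv ℝ φ x (pGradient p u x))) := by
  have hE0 : 0 ≤ E := le_trans (by positivity) hE
  have hx' : 0 < ‖x‖ := norm_pos_iff.2 hx
  have htr0 : 0 ≤ ∑ i, T (EuclideanSpace.single i 1) i := le_trans (by positivity) htr
  rw [fderiv_apply_pGradient hp]
  obtain hφ0 | hφ0 := hφ.eq_or_lt
  · rw [← hφ0, zero_pow (by omega), zero_pow (by omega)]
    simpa using hE0
  -- Where Du = 0 all gradient terms vanish, and nonnegativity of the trace suffices.
  obtain hG | hG := (norm_nonneg (gradient u x)).eq_or_lt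
  · have h0 : pGradient p u x = 0 := by
      simp [pGradient, norm_eq_zero.1 hG.symm]
    rw [h0, ← hG, Real.zero_rpow (show p ≠ 0 by linarith)]
    simp only [map_zero, zero_mul, mul_zero, add_zero]
    have : 0 ≤ Real.exp (s * u x) * φ x ^ N * ∑ i, T (EuclideanSpace.single i 1) i := by positivity
    linarith
  have hy := young_absorption (α := α) (u := u x) hc₀ hs ha hb he habe hgrad hexp hN (by omega) hx'
    hG hφ0 hφ1 (norm_nonneg (fderiv ℝ φ x))
  have h1 : -(‖fderiv ℝ φ x‖ * ‖gradient u x‖ ^ (p - 1)) ≤ fderiv ℝ φ x (pGradient p u x) := by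
    rw [← norm_pGradient hp]
    exact (abs_le.1 ((fderiv ℝ φ x).le_opNorm (pGradient p u x))).1
  have h2 : -(Real.exp (s * u x) *
      (N * φ x ^ (N - 1) * (‖fderiv ℝ φ x‖ * ‖gradient u x‖ ^ (p - 1)))) ≤
      Real.exp (s * u x) * (N * φ x ^ (N - 1) * fderiv ℝ φ x (pGradient p u x)) := by
    calc _ = Real.exp (s * u x) * (N * φ x ^ (N - 1) *
          -(‖fderiv ℝ φ x‖ * ‖gradient u x‖ ^ (p - 1))) := by ring
      _ ≤ _ := by gcongr
  have h3 : c₀ * (‖x‖ ^ α * ‖gradient u x‖ ^ β * Real.exp (c * u x)) *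
      (Real.exp (s * u x) * φ x ^ N) ≤
      Real.exp (s * u x) * φ x ^ N * ∑ i, T (EuclideanSpace.single i 1) i := by
    rw [mul_comm _ (Real.exp (s * u x) * φ x ^ N)]
    gcongr
  linarith

/-- Scaled cutoff functions. -/
theorem exists_cutoff (n : ℕ) : ∃ B : ℝ, 0 ≤ B ∧ ∃ φ : ℝ → RSpace n → ℝ, ∀ R, 0 < R →
    ContDiff ℝ 1 (φ R) ∧ (∀ x, 0 ≤ φ R x) ∧ (∀ x, φ R x ≤ 1) ∧ (∀ x, ‖x‖ ≤ R → φ R x = 1) ∧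
    (∀ x, 2 * R ≤ ‖x‖ → φ R x = 0) ∧
    (∀ x, ‖x‖ < R → fderiv ℝ (φ R) x = 0) ∧ (∀ x, 2 * R < ‖x‖ → fderiv ℝ (φ R) x = 0) ∧
    ∀ x, ‖fderiv ℝ (φ R) x‖ ≤ B / R := by
  let b : ContDiffBump (0 : RSpace n) := ⟨1, 2, one_pos, one_lt_two⟩
  have hb : ContDiff ℝ 1 b := b.contDiff
  obtain ⟨B, hB⟩ := (b.hasCompactSupport.fderiv (𝕜 := ℝ)).exists_bound_of_continuous
    (hb.continuous_fderiv one_ne_zero)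
  have hB0 : 0 ≤ B := (norm_nonneg _).trans (hB 0)
  refine ⟨B, hB0, fun R x => b (R⁻¹ • x), fun R hR => ?_⟩
  have hsm : ∀ x : RSpace n, ‖R⁻¹ • x‖ = ‖x‖ / R := fun x => by
    rw [norm_smul, norm_inv, Real.norm_of_nonneg hR.le]
    ring
  have h1 : ∀ x : RSpace n, ‖x‖ ≤ R → b (R⁻¹ • x) = 1 := fun x hx =>
    b.one_of_mem_closedBall (by simpa [b, hsm] using (div_le_one hR).2 hx)
  have h2 : ∀ x : RSpace n, 2 * R ≤ ‖x‖ → b (R⁻¹ • x) = 0 := fun x hx =>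
    b.zero_of_le_dist (by simpa [b, hsm] using (le_div_iff₀ hR).2 hx)
  refine ⟨hb.comp (contDiff_const_smul _), fun x => b.nonneg, fun x => b.le_one, h1, h2,
    fun x hx => ?_, fun x hx => ?_, fun x => ?_⟩
  · have : (fun x : RSpace n => b (R⁻¹ • x)) =ᶠ[𝓝 x] fun _ => 1 := by
      filter_upwards [continuous_norm.continuousAt.eventually (gt_mem_nhds hx)] with y hy
      exact h1 y (le_of_lt hy)
    rw [this.fderiv_eq]
    simp
  · have : (fun x : RSpace n => b (R⁻¹ • x)) =ᶠ[𝓝 x] fun _ => 0 := by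
      filter_upwards [continuous_norm.continuousAt.eventually (lt_mem_nhds hx)] with y hy
      exact h2 y (le_of_lt hy)
    rw [this.fderiv_eq]
    simp
  · rw [fderiv_comp_smul (f := b), norm_smul, norm_inv, Real.norm_of_nonneg hR.le, inv_mul_eq_div]
    gcongr
    exact hB _
end

/-! ### Liouville theorem and the equivalences with c = 0. -/

noncomputable section
open MeasureTheory Set Filter Topology

/-- Liouville theorem: entire solutions of
`div (|Du|^{p-2} Du) ≥ c₀ |x|^α |Du|^β e^{cu}` off the origin are constant if `c > 0`. -/
theorem eq_of_le_pLaplacian {n : ℕ} {p α β c c₀ : ℝ} (hp : 1 < p) (hα : -1 < α)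
    (hβ : β < p - 1) (hc : 0 < c) (hc₀ : 0 < c₀) {u : RSpace (n + 1) → ℝ} (hu : ContDiff ℝ 1 u)
    (hd : ∀ x, x ≠ 0 → DifferentiableAt ℝ (pGradient p u) x)
    (htr : ∀ x, x ≠ 0 → c₀ * (‖x‖ ^ α * ‖gradient u x‖ ^ β * Real.exp (c * u x)) ≤
      ∑ i, fderiv ℝ (pGradient p u) x (EuclideanSpace.single i 1) i) (x y : RSpace (n + 1)) :
    u x = u y := by
  have hn1 : (0 : ℝ) < (n : ℝ) + 1 := by positivity
  -- The three Young relations leave the ratio t = c/s free. This choice makes (αa + 1)/e = n + 1 +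
  -- p, so the error beats the volume R^(n+1) by a factor R^(-p).
  obtain ⟨t, ht⟩ : ∃ t : ℝ, t = (α + p - β) / (n + 1) := ⟨_, rfl⟩
  have hα' : 0 < α + p - β := by linarith
  have ht0 : 0 < t := ht ▸ div_pos hα' hn1
  have htn : α + p - β = t * (n + 1) := by rw [ht, div_mul_cancel₀ _ hn1.ne']
  obtain ⟨s, hs⟩ : ∃ s : ℝ, s = c / t := ⟨_, rfl⟩
  have hs0 : 0 < s := hs ▸ div_pos hc ht0
  have hst : s * t = c := by rw [hs, div_mul_cancel₀ _ ht0.ne']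
  have hden : 0 < p - β + p * t := by
    have : 0 < p * t := by positivity
    linarith
  obtain ⟨a, ha⟩ : ∃ a : ℝ, a = 1 / (p - β + p * t) := ⟨_, rfl⟩
  have ha0 : 0 < a := ha ▸ one_div_pos.2 hden
  have hae : a * (p - β + p * t) = 1 := by rw [ha, one_div_mul_cancel hden.ne']
  obtain ⟨e, he⟩ : ∃ e : ℝ, e = a * t := ⟨_, rfl⟩
  have he0 : 0 < e := he ▸ mul_pos ha0 ht0
  obtain ⟨b, hb⟩ : ∃ b : ℝ, b = a * (p - 1 - β + (p - 1) * t) := ⟨_, rfl⟩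
  have hb0 : 0 < b := by
    rw [hb]
    have : 0 < (p - 1) * t := mul_pos (by linarith) ht0
    exact mul_pos ha0 (by linarith)
  have habe : a + b + e = 1 := by rw [hb, he]; linear_combination hae
  have hgrad : a * β + b * p = p - 1 := by
    rw [hb]
    linear_combination (p - 1) * hae
  have hexp : a * (c + s) + b * s = s := by
    rw [hb, ← hst]
    linear_combination s * hae
  have hpow : α * a + 1 = e * (n + 1 + p) := by
    rw [he]
    linear_combination -hae + a * htn
  obtain ⟨N₀, hN₀⟩ := exists_nat_ge (1 / e)
  obtain ⟨N, hNdef⟩ : ∃ N : ℕ, N = N₀ + 2 := ⟨_, rfl⟩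
  have hN2 : 2 ≤ N := by omega
  have hN : 1 ≤ N * e := by
    have h1 : 1 / e ≤ N := hN₀.trans (by rw [hNdef]; push_cast; linarith)
    calc 1 = 1 / e * e := (one_div_mul_cancel he0.ne').symm
      _ ≤ N * e := by gcongr
  obtain ⟨B, hB0, φ, hφ⟩ := exists_cutoff (n + 1)
  set κ := N * (a / c₀) ^ a * (2 * b / s) ^ b with hκ
  have hκ0 : 0 ≤ κ := by positivity
  set M := e * (κ * (B * 2 ^ |α * a|)) ^ (1 / e) with hM
  have hM0 : 0 ≤ M := by positivity
  have hΦ := continuous_pGradient hp hu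
  have hgc := continuous_gradient hu
  set H : RSpace (n + 1) → ℝ := fun x => ‖gradient u x‖ ^ p * Real.exp (s * u x) with hH
  have hH0 : ∀ x, 0 ≤ H x := fun x => by positivity
  have hHc : Continuous H := (hgc.norm.rpow_const fun _ => .inr (by linarith)).mul
    (Real.continuous_exp.comp (continuous_const.mul hu.continuous))
  -- Dφ lives on R ≤ |x| ≤ 2R, where |x|^(-αa) is comparable to R^(-αa) whatever the sign of α.
  have herr : ∀ R, 0 < R → ∀ x, x ≠ 0 →
      e * (κ * (‖fderiv ℝ (φ R) x‖ * ‖x‖ ^ (-(α * a)))) ^ (1 / e) ≤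
        M * R ^ (-((n : ℝ) + 1 + p)) := fun R hR x hx => by
    obtain ⟨-, -, -, -, -, hin, hout, hbd⟩ := hφ R hR
    have hx' : 0 < ‖x‖ := norm_pos_iff.2 hx
    have hq : ‖fderiv ℝ (φ R) x‖ * ‖x‖ ^ (-(α * a)) ≤
        B * 2 ^ |α * a| * R ^ (-(α * a + 1)) := by
      by_cases h1 : ‖x‖ < R
      · rw [hin x h1, norm_zero, zero_mul]
        positivity
      by_cases h2 : 2 * R < ‖x‖
      · rw [hout x h2, norm_zero, zero_mul]
        positivity
      have h3 : ‖x‖ ^ (-(α * a)) ≤ 2 ^ |α * a| * R ^ (-(α * a)) := by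
        have h4 : 1 ≤ ‖x‖ / R := (one_le_div hR).2 (not_lt.1 h1)
        have h5 : ‖x‖ / R ≤ 2 := (div_le_iff₀ hR).2 (not_lt.1 h2)
        calc ‖x‖ ^ (-(α * a)) = (‖x‖ / R) ^ (-(α * a)) * R ^ (-(α * a)) := by
              rw [← Real.mul_rpow (by positivity) hR.le, div_mul_cancel₀ _ hR.ne']
          _ ≤ (‖x‖ / R) ^ |α * a| * R ^ (-(α * a)) := by
              gcongr
              exact neg_le_abs _
          _ ≤ 2 ^ |α * a| * R ^ (-(α * a)) := by gcongr
      calc ‖fderiv ℝ (φ R) x‖ * ‖x‖ ^ (-(α * a))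
          ≤ B / R * (2 ^ |α * a| * R ^ (-(α * a))) := by
            gcongr
            exact hbd x
        _ = B * 2 ^ |α * a| * R ^ (-(α * a + 1)) := by
            rw [neg_add, Real.rpow_add hR, Real.rpow_neg_one]
            ring
    calc e * (κ * (‖fderiv ℝ (φ R) x‖ * ‖x‖ ^ (-(α * a)))) ^ (1 / e)
        ≤ e * (κ * (B * 2 ^ |α * a| * R ^ (-(α * a + 1)))) ^ (1 / e) := by gcongr
      _ = M * R ^ (-((n : ℝ) + 1 + p)) := by
          rw [← mul_assoc κ, Real.mul_rpow (by positivity) (by positivity), ← Real.rpow_mul hR.le,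
            hpow, hM, ← mul_assoc]
          congr 2
          field_simp
  have hint : ∀ R, 0 < R → s / 2 * ∫ x, H x * φ R x ^ N ≤ M * 4 ^ (n + 1) * R ^ (-p) :=
      fun R hR => by
    obtain ⟨hsm, h0, h1, -, hz, -, -, -⟩ := hφ R hR
    set ψ : RSpace (n + 1) → ℝ := fun x => Real.exp (s * u x) * φ R x ^ N with hψ
    have hψd : ∀ x, HasFDerivAt ψ (Real.exp (s * u x) • ((N * φ R x ^ (N - 1)) •
        fderiv ℝ (φ R) x) + φ R x ^ N • (Real.exp (s * u x) • (s • fderiv ℝ u x))) x := fun x => by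
      have h2 := (((hu.differentiable one_ne_zero x).hasFDerivAt.const_mul s).exp).mul
        ((hsm.differentiable one_ne_zero x).hasFDerivAt.pow N)
      refine h2.congr_fderiv ?_
      simp
    have hle := integral_le_of_le_divergence (ρ := 2 * R) (E := M * R ^ (-((n : ℝ) + 1 + p)))
      (V := fun x => ψ x • pGradient p u x)
      (V' := fun x => ψ x • fderiv ℝ (pGradient p u) x +
        (Real.exp (s * u x) • ((N * φ R x ^ (N - 1)) • fderiv ℝ (φ R) x) +
          φ R x ^ N • (Real.exp (s * u x) • (s • fderiv ℝ u x))).smulRight (pGradient p u x))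
      (G := fun x => s / 2 * (H x * φ R x ^ N)) (by positivity)
      ((continuous_iff_continuousAt.2 fun x => (hψd x).continuousAt).smul hΦ)
      (fun x hx => (hψd x).smul (hd x hx).hasFDerivAt)
      (fun x hx => by simp [hψ, hz x hx, show N ≠ 0 by omega])
      (continuous_const.mul (hHc.mul (hsm.continuous.pow N)))
      (fun x hx => by simp [hz x hx, show N ≠ 0 by omega])
      (fun x hx => by
        have h3 := le_divergence_of_trace hp hc₀ hs0 ha0 hb0 he0 habe hgrad hexp hN hN2 hx (h0 x)
          (h1 x) (htr x hx) (herr R hR x hx)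
        refine h3.trans_eq ?_
        have hsum : ∀ L : RSpace (n + 1) →L[ℝ] ℝ, ∀ v : RSpace (n + 1),
            ∑ i, L (EuclideanSpace.single i 1) * v i = L v := fun L v => by
          conv_rhs => rw [← (EuclideanSpace.basisFun (Fin (n + 1)) ℝ).sum_repr v]
          simp [map_sum, mul_comm]
        simp only [add_apply, smul_apply, ContinuousLinearMap.smulRight_apply, PiLp.add_apply,
          PiLp.smul_apply, smul_eq_mul, Finset.sum_add_distrib, ← Finset.mul_sum]
        have h4 := hsum (Real.exp (s * u x) • ((N * φ R x ^ (N - 1)) • fderiv ℝ (φ R) x) +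
          φ R x ^ N • (Real.exp (s * u x) • (s • fderiv ℝ u x))) (pGradient p u x)
        simp only [add_apply, smul_apply, smul_eq_mul] at h4
        rw [h4]
        ring)
    rw [integral_const_mul] at hle
    refine hle.trans_eq ?_
    have : R ^ (-p) = R ^ (-((n : ℝ) + 1 + p)) * R ^ (n + 1) := by
      rw [← Real.rpow_natCast R (n + 1), ← Real.rpow_add hR]
      congr 1
      push_cast
      ring
    rw [this, show (2 * (2 * R)) = 4 * R by ring, mul_pow]
    ring
  have hHzero : ∀ x, H x = 0 := fun x₁ => by
    by_contra hne
    set R₀ := ‖x₁‖ + 1 with hR₀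
    have hR₀0 : 0 < R₀ := by positivity
    obtain ⟨hsm₀, h0₀, h1₀, hone₀, hz₀, -, -, -⟩ := hφ R₀ hR₀0
    have hcont : ∀ R, 0 < R → Continuous fun x => H x * φ R x ^ N := fun R hR =>
      hHc.mul ((hφ R hR).1.continuous.pow N)
    have hcs : ∀ R, 0 < R → Integrable fun x => H x * φ R x ^ N := fun R hR => by
      obtain ⟨hsm, -, -, -, hz, -, -, -⟩ := hφ R hR
      refine (hcont R hR).integrable_of_hasCompactSupport ?_
      refine HasCompactSupport.intro (isCompact_closedBall 0 (2 * R)) fun x hx => ?_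
      rw [hz x (by simpa using (not_le.1 (by simpa using hx)).le),
        zero_pow (by omega), mul_zero]
    have hpos : 0 < ∫ x, H x * φ R₀ x ^ N := by
      refine (hcont R₀ hR₀0).integral_pos_of_hasCompactSupport_nonneg_nonzero
        ?_ (fun x => mul_nonneg (hH0 x) (pow_nonneg (h0₀ x) N)) (x := x₁) ?_
      · refine HasCompactSupport.intro (isCompact_closedBall 0 (2 * R₀)) fun x hx => ?_
        rw [hz₀ x (by simpa using (not_le.1 (by simpa using hx)).le),
          zero_pow (by omega), mul_zero]
      · rw [hone₀ x₁ (by linarith), one_pow, mul_one]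
        exact hne
    have hlim : Tendsto (fun R : ℝ => M * 4 ^ (n + 1) * R ^ (-p)) atTop (𝓝 0) := by
      simpa using (tendsto_rpow_neg_atTop (show 0 < p by linarith)).const_mul (M * 4 ^ (n + 1))
    have hbound : ∀ᶠ R in atTop, s / 2 * ∫ x, H x * φ R₀ x ^ N ≤ M * 4 ^ (n + 1) * R ^ (-p) := by
      -- For R ≥ 2R₀ the cutoffs are ordered: the one at scale R is 1 wherever the one at scale R₀
      -- is nonzero.
      filter_upwards [eventually_ge_atTop (2 * R₀)] with R hR
      have hRpos : 0 < R := by linarith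
      obtain ⟨-, h0, -, hone, -, -, -, -⟩ := hφ R hRpos
      refine le_trans ?_ (hint R hRpos)
      refine mul_le_mul_of_nonneg_left (integral_mono (hcs R₀ hR₀0) (hcs R hRpos) fun x => ?_)
        (by positivity)
      refine mul_le_mul_of_nonneg_left (pow_le_pow_left₀ (h0₀ x) ?_ N) (hH0 x)
      by_cases hx : ‖x‖ ≤ R
      · rw [hone x hx]
        exact h1₀ x
      · rw [hz₀ x (by linarith)]
        exact h0 x
    have := ge_of_tendsto hlim hbound
    have : 0 < s / 2 * ∫ x, H x * φ R₀ x ^ N := mul_pos (half_pos hs0) hpos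
    linarith
  refine is_const_of_fderiv_eq_zero (𝕜 := ℝ) (hu.differentiable one_ne_zero) (fun x => ?_) x y
  have h := hHzero x
  simp only [hH, mul_eq_zero, Real.exp_ne_zero, or_false] at h
  have h2 : gradient u x = 0 :=
    norm_eq_zero.1 ((Real.rpow_eq_zero (norm_nonneg _) (by linarith)).1 h)
  simpa [gradient] using h2

variable {n : ℕ} {K : Set (Fin (n + 1) → ℝ)} {F : (Fin (n + 1) → ℝ) → ℝ} {p α β c : ℝ}

theorem not_isAdmissibleSubsolution_exp (hp : 1 < p) (hα : -1 < α) (hβ : β < p - 1) (hc : 0 < c)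
    {C : ℝ} (hC : 0 < C) (hF : ∀ lam ∈ K, F lam ≤ C * ∑ i, lam i)
    {u : RSpace (n + 1) → ℝ} (hu : ContDiff ℝ 1 u) :
    ¬ IsAdmissibleSubsolution K F p α β (fun t => Real.exp (c * t)) u := by
  rintro ⟨⟨x, y, hxy⟩, h⟩
  refine hxy (eq_of_le_pLaplacian hp hα hβ hc (one_div_pos.2 hC) hu (fun x hx => (h x hx).1)
    (fun x hx => ?_) x y)
  obtain ⟨-, -, lam, hlam, hK, hle⟩ := h x hx
  rw [hlam.trace_eq_sum, one_div_mul_eq_div, div_le_iff₀' hC]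
  exact hle.trans (hF lam hK)

/-- The three existence criteria for an operator that is bounded below by the smallest eigenvalue
and above by a multiple of the trace. -/
theorem exists_isAdmissibleSubsolution_iff (hp : 1 < p) (hα : -1 < α) (hβ : β < p - 1)
    (hc : 0 ≤ c) (hlow : ∀ lam t, 0 < t → (∀ i, t ≤ lam i) → lam ∈ K ∧ t ≤ F lam)
    {C : ℝ} (hC : 0 < C) (hup : ∀ lam ∈ K, F lam ≤ C * ∑ i, lam i) :
    (p ≤ α + β + 2 →
        ((∃ u : RSpace (n + 1) → ℝ, ContDiff ℝ 2 u ∧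
            IsAdmissibleSubsolution K F p α β (fun t => Real.exp (c * t)) u) ↔ c = 0)) ∧
      (α + β + 2 < p → ∀ δ : ℝ, 1 < δ → δ < (p - β - 1) / (p - α - β - 2) →
        ((∃ u : RSpace (n + 1) → ℝ, ContDiff ℝ 1 u ∧ ContDiffOn ℝ 2 u {0}ᶜ ∧
            MemSobolevTwoLocal δ u ∧
            IsAdmissibleSubsolution K F p α β (fun t => Real.exp (c * t)) u) ↔ c = 0)) ∧
        ((∃ u : RSpace (n + 1) → ℝ, ContDiff ℝ 1 u ∧ ContDiffOn ℝ 2 u {0}ᶜ ∧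
            IsAdmissibleSubsolution K F p α β (fun t => Real.exp (c * t)) u) ↔ c = 0) := by
  have hno : ∀ u : RSpace (n + 1) → ℝ, ContDiff ℝ 1 u →
      IsAdmissibleSubsolution K F p α β (fun t => Real.exp (c * t)) u → c = 0 := fun u hu h => by
    by_contra hne
    exact not_isAdmissibleSubsolution_exp hp hα hβ (hc.lt_of_ne' hne) hC hup hu h
  obtain ⟨A, hA, hsub⟩ := exists_isAdmissibleSubsolution_radialPower hp hα hβ hlow
  have hb : 0 < p - 1 - β := by linarith
  have hγ : 1 < 1 + (α + 1) / (p - 1 - β) := by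
    linarith [div_pos (show 0 < α + 1 by linarith) hb]
  refine ⟨fun hpα => ⟨fun ⟨u, hu, h⟩ => hno u (hu.of_le one_le_two) h, ?_⟩,
    fun hpα δ hδ1 hδ => ⟨fun ⟨u, hu, _, _, h⟩ => hno u hu h, ?_⟩,
    fun ⟨u, hu, _, h⟩ => hno u hu h, ?_⟩
  · rintro rfl
    refine ⟨_, contDiff_two_radialPower ?_, hsub⟩
    have : 1 ≤ (α + 1) / (p - 1 - β) := (one_le_div hb).2 (by linarith)
    linarith
  · rintro rfl
    refine ⟨_, contDiff_radialPower hγ, contDiffOn_radialPower,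
      memSobolevTwoLocal_radialPower hγ hδ1.le ?_, hsub⟩
    have hq : 0 < p - α - β - 2 := by linarith
    rw [lt_div_iff₀ hq] at hδ
    -- This is γ - 2, so (γ-2)δ > -1 is precisely the upper bound on δ.
    have h1 : 1 + (α + 1) / (p - 1 - β) - 2 = -((p - α - β - 2) / (p - 1 - β)) := by
      field_simp
      ring
    rw [h1, neg_mul, neg_lt_neg_iff, div_mul_eq_mul_div, div_lt_one hb]
    linarith
  · rintro rfl
    exact ⟨_, contDiff_radialPower hγ, contDiffOn_radialPower, hsub⟩
end

/-! ### Application to the two operators. -/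

theorem corollary1p1 (n k : ℕ) (hk : 1 ≤ k) (hkn : k ≤ n)
    (p α β c : ℝ) (hp : 1 < p) (hα : -1 < α) (hβ : β < p - 1) (hc : 0 ≤ c) :
    -- the `k`-Hessian type equation
    ((p ≤ α + β + 2 →
        ((∃ u : RSpace n → ℝ, ContDiff ℝ 2 u ∧
            IsSubsolutionS k p α β (fun t => Real.exp (c * t)) u) ↔ c = 0)) ∧
      (α + β + 2 < p → 0 ≤ (p - 1) * α + β →
        ∀ δ : ℝ, 1 < δ → δ < (p - β - 1) / (p - α - β - 2) →
        ((∃ u : RSpace n → ℝ, ContDiff ℝ 1 u ∧ ContDiffOn ℝ 2 u {0}ᶜ ∧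
            MemSobolevTwoLocal δ u ∧
            IsSubsolutionS k p α β (fun t => Real.exp (c * t)) u) ↔ c = 0)) ∧
      (α < 1 / (k : ℝ) - 1 →
        ((∃ u : RSpace n → ℝ, ContDiff ℝ 1 u ∧ ContDiffOn ℝ 2 u {0}ᶜ ∧
            IsSubsolutionS k p α β (fun t => Real.exp (c * t)) u) ↔ c = 0))) ∧
    -- the `Π_k`-Hessian type equation
    ((p ≤ α + β + 2 →
        ((∃ u : RSpace n → ℝ, ContDiff ℝ 2 u ∧
            IsSubsolutionPi k p α β (fun t => Real.exp (c * t)) u) ↔ c = 0)) ∧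
      (α + β + 2 < p → 0 ≤ (p - 1) * α + β →
        ∀ δ : ℝ, 1 < δ → δ < (p - β - 1) / (p - α - β - 2) →
        ((∃ u : RSpace n → ℝ, ContDiff ℝ 1 u ∧ ContDiffOn ℝ 2 u {0}ᶜ ∧
            MemSobolevTwoLocal δ u ∧
            IsSubsolutionPi k p α β (fun t => Real.exp (c * t)) u) ↔ c = 0)) ∧
      (α < (k : ℝ) / (n : ℝ) - 1 →
        ((∃ u : RSpace n → ℝ, ContDiff ℝ 1 u ∧ ContDiffOn ℝ 2 u {0}ᶜ ∧
            IsSubsolutionPi k p α β (fun t => Real.exp (c * t)) u) ↔ c = 0))) := by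
  obtain ⟨n, rfl⟩ : ∃ m, n = m + 1 := ⟨n - 1, by omega⟩
  have hk0 : k ≠ 0 := by omega
  have hch : (n + 1).choose k ≠ 0 := (Nat.choose_pos hkn).ne'
  obtain ⟨hS1, hS2, hS3⟩ := exists_isAdmissibleSubsolution_iff (n := n) (K := gardingCone (n + 1) k)
    (F := fun lam => sumOfProducts k lam ^ (1 / (k : ℝ))) hp hα hβ hc
    (fun lam t ht h => ⟨mem_gardingCone_of_le hkn ht h,
      le_rpow_inv_of_pow_le hk0 ht.le (pow_le_sumOfProducts hkn ht h)⟩)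
    (by positivity) (fun lam h => rpow_sumOfProducts_le hk h)
  obtain ⟨hP1, hP2, hP3⟩ := exists_isAdmissibleSubsolution_iff (n := n) (K := sumCone (n + 1) k)
    (F := fun lam => productOfSums k lam ^ (1 / ((n + 1).choose k : ℝ))) hp hα hβ hc
    (fun lam t ht h => ⟨fun s hs => ht.trans_le (le_sum_of_le hk ht h hs),
      le_rpow_inv_of_pow_le hch ht.le (pow_le_productOfSums hk ht h)⟩)
    (Nat.cast_pos.2 (Nat.choose_pos (by omega : k - 1 ≤ n + 1 - 1)))
    (fun lam h => rpow_productOfSums_le hk hkn h)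
  exact ⟨⟨hS1, fun h _ => hS2 h, fun _ => hS3⟩, ⟨hP1, fun h _ => hP2 h, fun _ => hP3⟩⟩
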